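/- Let $I=[0,1]$. A seller offers two goods to one buyer whose values $x_1,x_2\in I$ are independent with common density $f$; $f$ is absolutely continuous and positive on $I$, $F$ is its distribution function. Put $h(x_1,x_2)=3f(x_1)f(x_2)+x_1f'(x_1)f(x_2)+x_2f'(x_2)f(x_1)$ and assume (regularity) that $h(x_1,x_2)-f(1)f(x_1)$ and $h(x_1,x_2)-f(1)f(x_2)$ are nonnegative on $I^2$ and that $h$ is absolutely continuous in each coordinate. A mechanism consists of allocation probabilities $a_1,a_2:I^2\to I$ and a payment $\pi:I^2\to\mathbb R_+$; it is truthful if $u(b;x)=a_1(b)x_1+a_2(b)x_2-\pi(b)$ satisfies $u(b;x)\le u(x;x)$ and $u(x;x)\ge 0$ for all $x,b\in I^2$. Its utility function is $x\mapsto u(x;x)$, its revenue is $\int_{I^2}\pi(x)f(x_1)f(x_2)\,dx$, and a truthful mechanism is optimal if no truthful mechanism has larger revenue. A feasible utility function is a continuous convex $u:I^2\to\mathbb R_+$ with partial derivatives in $[0,1]$ a.e.; its revenue is $\mathcal R(u)=\int_0^1\int_0^1\left(x_1\frac{\partial u}{\partial x_1}+x_2\frac{\partial u}{\partial x_2}-u\right)f(x_1)f(x_2)\,dx_1\,dx_2$.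 Say that the optimal mechanism is given by $u$ if $u$ maximizes $\mathcal R$ over the feasible utility functions, $u$ is the utility function of some truthful mechanism, and every truthful mechanism with utility function $u$ is optimal. Let $H(t)=tf'(t)/f(t)$ for $t\in I$ and $G(t)=tf(t)/(1-F(t))$ for $t\in[0,1)$, with $G(1)=\lim_{t\to1^-}G(t)\in(-\infty,\infty]$. Assume that $f$ is differentiable on $I$, that $G$ and $H$ are differentiable, that $G$ is strictly increasing and convex, $H$ is (weakly) decreasing and concave, $G+H$ is (weakly) increasing on $[0,1)$, and $G(1)\ge 2+H(0)$. Then: 1. $s(t)=G^{-1}(2+H(t))$ is a well-defined function from $I$ to $[0,1)$ that is (weakly) decreasing, concave and differentiable, with $s'(t)>-1$ for all $t\in I$ with $t\le s(t)$, and $$\frac{s(t)f(s(t))}{1-F(s(t))}=2+\frac{tf'(t)}{f(t)}\quad\text{for all }t\in I.$$ 2. Let $E(p)=\int_0^1\int_0^1 h\,dx_1\,dx_2-\int_0^p\int_0^{p-x_2}h\,dx_1\,dx_2-2f(1)$. If $E(s(0))\le 0$, then $E$ has exactly one root $p$ in $[0,s(0)]$, the mechanism that offers only the full bundle, deterministically,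 at price $p$ is optimal, and the optimal mechanism is given by $u(x)=\max\{0,x_1+x_2-p\}$. 3. If $E(s(0))>0$, then the equation $$\int_{x^*}^{s(x^*)}\int_{s(x^*)+x^*-x_2}^1 h\,dx_1\,dx_2+\int_{s(x^*)}^1\int_{x^*}^1 h\,dx_1\,dx_2=2f(1)(1-F(x^*))$$ has exactly one solution $x^*\in[0,s(0)]$, and with $p=x^*+s(x^*)$ the optimal mechanism is given by $$u(x)=\max\{0,\;x_1-s(x_2),\;x_2-s(x_1),\;x_1+x_2-p\}.$$ -/

import Mathlib

open Set Filter Topology MeasureTheory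

noncomputable section

namespace TwoGoods

/-- The interval `I = [0,1]` of possible values of one item. -/
def unitI : Set ℝ := Icc 0 1

/-- The set `I × I` of value profiles `(x₁, x₂)`. -/
def square : Set (ℝ × ℝ) := unitI ×ˢ unitI

/-! ### Distributions -/

/-- `f` is an absolutely continuous, positive probability density on `[0,1]`. -/
structure IsDensity (f : ℝ → ℝ) : Prop where
  absCont : AbsolutelyContinuousOnInterval f 0 1
  pos : ∀ t ∈ unitI, 0 < f t
  integral_eq_one : ∫ t in (0 : ℝ)..1, f t = 1

/-- The distribution function `F(t) = ∫₀ᵗ f`. -/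
def distr (f : ℝ → ℝ) (t : ℝ) : ℝ := ∫ u in (0 : ℝ)..t, f u

/-- The derivative `f'` of a function on `[0,1]` (one-sided at the end points). -/
def dens' (f : ℝ → ℝ) (t : ℝ) : ℝ := derivWithin f unitI t

/-- `h(x₁,x₂) = 3 f₁(x₁) f₂(x₂) + x₁ f₁'(x₁) f₂(x₂) + x₂ f₂'(x₂) f₁(x₁)`. -/
def hFun (f₁ f₂ : ℝ → ℝ) (x₁ x₂ : ℝ) : ℝ :=
  3 * f₁ x₁ * f₂ x₂ + x₁ * dens' f₁ x₁ * f₂ x₂ + x₂ * dens' f₂ x₂ * f₁ x₁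

/-- The regularity assumption on a pair of densities. -/
structure Regular (f₁ f₂ : ℝ → ℝ) : Prop where
  nonneg₁ : ∀ x₁ ∈ unitI, ∀ x₂ ∈ unitI, 0 ≤ hFun f₁ f₂ x₁ x₂ - f₂ 1 * f₁ x₁
  nonneg₂ : ∀ x₁ ∈ unitI, ∀ x₂ ∈ unitI, 0 ≤ hFun f₁ f₂ x₁ x₂ - f₁ 1 * f₂ x₂
  absCont₁ : ∀ x₂ ∈ unitI, AbsolutelyContinuousOnInterval (fun x₁ => hFun f₁ f₂ x₁ x₂) 0 1
  absCont₂ : ∀ x₁ ∈ unitI, AbsolutelyContinuousOnInterval (fun x₂ => hFun f₁ f₂ x₁ x₂) 0 1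

/-- `G(t) = t f(t) / (1 - F(t))`; meaningful for `t ∈ [0,1)`. -/
def gFun (f : ℝ → ℝ) (t : ℝ) : ℝ := t * f t / (1 - distr f t)

/-- `H(t) = t f'(t) / f(t)`. -/
def etaFun (f : ℝ → ℝ) (t : ℝ) : ℝ := t * dens' f t / f t

/-- `s(t) = G⁻¹(2 + H(t))`, with `G` regarded as a function on `[0,1)`. -/
def sFun (f : ℝ → ℝ) (t : ℝ) : ℝ :=
  Function.invFunOn (gFun f) (Ico 0 1) (2 + etaFun f t)

/-! ### Mechanisms, utilities and revenue -/

/-- A direct-revelation mechanism: allocation probabilities of the two items and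
the payment, as functions of the bids. -/
structure Mechanism where
  alloc₁ : ℝ × ℝ → ℝ
  alloc₂ : ℝ × ℝ → ℝ
  pay : ℝ × ℝ → ℝ

/-- The utility of a buyer with values `x` who bids `b`. -/
def Mechanism.utility (M : Mechanism) (b x : ℝ × ℝ) : ℝ :=
  M.alloc₁ b * x.1 + M.alloc₂ b * x.2 - M.pay b

/-- Allocation probabilities in `[0,1]`, nonnegative payments, incentive compatibility
and individual rationality. -/
structure Mechanism.IsTruthful (M : Mechanism) : Prop where
  alloc₁_mem : ∀ b ∈ square, M.alloc₁ b ∈ unitI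
  alloc₂_mem : ∀ b ∈ square, M.alloc₂ b ∈ unitI
  pay_nonneg : ∀ b ∈ square, 0 ≤ M.pay b
  incentive_compatible : ∀ x ∈ square, ∀ b ∈ square, M.utility b x ≤ M.utility x x
  individually_rational : ∀ x ∈ square, 0 ≤ M.utility x x

/-- The expected payment under truthful bidding, for independent values with densities
`f₁`, `f₂`. (For a truthful mechanism the payment is automatically bounded and Lebesgue
measurable on the square.) -/
def Mechanism.revenue (f₁ f₂ : ℝ → ℝ) (M : Mechanism) : ℝ :=
  ∫ x in square, M.pay x * f₁ x.1 * f₂ x.2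

/-- `M` is an optimal selling mechanism. -/
def IsOptimalMechanism (f₁ f₂ : ℝ → ℝ) (M : Mechanism) : Prop :=
  M.IsTruthful ∧ ∀ M' : Mechanism, M'.IsTruthful → M'.revenue f₁ f₂ ≤ M.revenue f₁ f₂

/-- `u` is the utility of a truthful buyer under `M`. -/
def Mechanism.Induces (M : Mechanism) (u : ℝ × ℝ → ℝ) : Prop :=
  ∀ x ∈ square, M.utility x x = u x

/-- The partial derivative with respect to the first coordinate. -/
def partial₁ (u : ℝ × ℝ → ℝ) (x : ℝ × ℝ) : ℝ := deriv (fun t => u (t, x.2)) x.1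

/-- The partial derivative with respect to the second coordinate. -/
def partial₂ (u : ℝ × ℝ → ℝ) (x : ℝ × ℝ) : ℝ := deriv (fun t => u (x.1, t)) x.2

/-- Feasible utility functions: nonnegative, convex, continuous on the square, with partial
derivatives in `[0,1]` almost everywhere (such functions are Lipschitz on the square,
in particular absolutely continuous). -/
structure IsFeasibleUtility (u : ℝ × ℝ → ℝ) : Prop where
  nonneg : ∀ x ∈ square, 0 ≤ u x
  convexOn : ConvexOn ℝ square u
  continuousOn : ContinuousOn u square
  partial₁_mem : ∀ᵐ x ∂(volume.restrict square), partial₁ u x ∈ unitI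
  partial₂_mem : ∀ᵐ x ∂(volume.restrict square), partial₂ u x ∈ unitI

/-- `R_{f₁,f₂}(u) = ∫₀¹∫₀¹ (∂u/∂x₁ · x₁ + ∂u/∂x₂ · x₂ - u) f₁(x₁) f₂(x₂) dx₁ dx₂`. -/
def utilityRevenue (f₁ f₂ : ℝ → ℝ) (u : ℝ × ℝ → ℝ) : ℝ :=
  ∫ x₂ in (0 : ℝ)..1, ∫ x₁ in (0 : ℝ)..1,
    (partial₁ u (x₁, x₂) * x₁ + partial₂ u (x₁, x₂) * x₂ - u (x₁, x₂)) * f₁ x₁ * f₂ x₂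

/-- `u` is feasible and attains the supremum of `R_{f₁,f₂}` over the feasible utilities. -/
def IsOptimalUtility (f₁ f₂ : ℝ → ℝ) (u : ℝ × ℝ → ℝ) : Prop :=
  IsFeasibleUtility u ∧
    ∀ v : ℝ × ℝ → ℝ, IsFeasibleUtility v → utilityRevenue f₁ f₂ v ≤ utilityRevenue f₁ f₂ u

/-- The optimal selling mechanism is the one given by the utility function `u`: `u` maximizes
the revenue functional, `u` is the utility of a truthful mechanism, and every truthful
mechanism with utility `u` is optimal. -/
def OptimalGivenBy (f₁ f₂ : ℝ → ℝ) (u : ℝ × ℝ → ℝ) : Prop :=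
  IsOptimalUtility f₁ f₂ u ∧
    (∃ M : Mechanism, M.IsTruthful ∧ M.Induces u) ∧
    ∀ M : Mechanism, M.IsTruthful → M.Induces u → IsOptimalMechanism f₁ f₂ M

open Classical in
/-- The deterministic mechanism that offers only the full bundle, at price `p`. -/
def fullBundling (p : ℝ) : Mechanism where
  alloc₁ b := if p ≤ b.1 + b.2 then 1 else 0
  alloc₂ b := if p ≤ b.1 + b.2 then 1 else 0
  pay b := if p ≤ b.1 + b.2 then p else 0

/-- `u(x) = max {0, x₁ - s(x₂), x₂ - s(x₁), x₁ + x₂ - p}`. -/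
def curveUtility (s : ℝ → ℝ) (p : ℝ) (x : ℝ × ℝ) : ℝ :=
  max 0 (max (x.1 - s x.2) (max (x.2 - s x.1) (x.1 + x.2 - p)))

/-! ### The two price equations for identically distributed values -/

/-- `∫₀¹∫₀¹ h dx - ∫₀ᵖ∫₀^{p-x₂} h dx - 2 f(1)`. -/
def bundleExpr (f : ℝ → ℝ) (p : ℝ) : ℝ :=
  (∫ x₂ in (0 : ℝ)..1, ∫ x₁ in (0 : ℝ)..1, hFun f f x₁ x₂)
    - (∫ x₂ in (0 : ℝ)..p, ∫ x₁ in (0 : ℝ)..(p - x₂), hFun f f x₁ x₂) - 2 * f 1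

/-- `∫_z^{s(z)}∫_{s(z)+z-x₂}^1 h dx + ∫_{s(z)}^1∫_z^1 h dx = 2 f(1) (1 - F(z))`. -/
def PriceEquation (f s : ℝ → ℝ) (z : ℝ) : Prop :=
  (∫ x₂ in z..(s z), ∫ x₁ in (s z + z - x₂)..1, hFun f f x₁ x₂)
    + (∫ x₂ in (s z)..1, ∫ x₁ in z..1, hFun f f x₁ x₂)
    = 2 * f 1 * (1 - distr f z)

end TwoGoods

end

open TwoGoods

noncomputable section

namespace TwoGoods

/-! Integration by parts turns the revenue of a utility `v` into `virtualRevenue f v`: a mass `f(1)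
f` on the right and top edges of the square, minus the positive density `h` inside it. The
derivatives of `v` disappear, and only nonnegativity and the slope bound `IsOneSidedLipschitz` are
needed of the competitor.

Two facts about the masses then decide everything. First, the `h`-mass of the slice `[q, 1]` at
height `a` is `f(1) f(a)` plus `f(a) (1 - F(q)) (2 + H(a) - G(q))`, so it balances the edge mass
exactly at `q = s(a)` (`integral_hFun`, `excess_eq`, `excess_sFun`). Second, for the corner regions
above `(a, b)` and the line `x₁ + x₂ = p`, the balance `deficiency f p a b` is nonpositive for all
`a, b ≥ z` as soon as it vanishes at `a = b = z` and `p ≤ t + s(t)` on `[z, 1]`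
(`deficiency_nonpos`). The two price equations say precisely that it vanishes there, with `z = 0`
for bundling and `p = z + s(z)` otherwise.

Optimality (`virtualRevenue_le`): let `w = u - v`. Where `u` sells nothing, `w ≤ 0`. In the strips
below and left of `z`, `u` has slope one along the slice and `v` at most one, so `w` is at most its
value on the edge, and the slice is balanced. In the bundle region `w` is monotone, so each of its
superlevel sets lies in a corner region, whose `h`-mass is at most the edge mass of the same
superlevel set; the layer-cake formula sums this over the levels (`setIntegral_region_le`).

The geometry of `s` comes from bounds on `H` and `G`. Since `H(0) = 0` and `H` decreases, `f`
decreases, whence `G(t) ≥ t / (1 - t)`; regularity at `(1, 1)` gives `H ≥ -1`. With convexity of `G`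
and concavity of `H` these yield `s' > -1` where `t ≤ s(t)`, and the position of `t + s(t)` relative
to the price line. Truthfulness of the menu follows from concavity of `s`: tangents to `s` give
affine minorants of `u`. -/

/-- The standing assumptions on the common density of the two values. -/
structure Admissible (f : ℝ → ℝ) : Prop where
  isDensity : IsDensity f
  regular : Regular f f
  differentiableOn : DifferentiableOn ℝ f unitI
  gFun_differentiableOn : DifferentiableOn ℝ (gFun f) (Ico 0 1)
  etaFun_differentiableOn : DifferentiableOn ℝ (etaFun f) unitI
  gFun_strictMonoOn : StrictMonoOn (gFun f) (Ico 0 1)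
  gFun_convexOn : ConvexOn ℝ (Ico 0 1) (gFun f)
  etaFun_antitoneOn : AntitoneOn (etaFun f) unitI
  etaFun_concaveOn : ConcaveOn ℝ unitI (etaFun f)

/-! ### Consequences of the assumptions for the density, its tail and the slices of `h`. -/

/-- The function `t ↦ t f'(t)`. -/
def scaledDeriv (f : ℝ → ℝ) (t : ℝ) : ℝ := t * dens' f t

/-- The excess of `∫_q^1 h(x, a) dx` over `f(1) f(a)`. -/
def excess (f : ℝ → ℝ) (a q : ℝ) : ℝ :=
  (2 * f a + scaledDeriv f a) * (1 - distr f q) - q * f q * f a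

theorem zero_mem_unitI : (0 : ℝ) ∈ unitI := ⟨le_rfl, zero_le_one⟩

theorem one_mem_unitI : (1 : ℝ) ∈ unitI := ⟨zero_le_one, le_rfl⟩

theorem uIcc_subset_unitI {a b : ℝ} (ha : a ∈ unitI) (hb : b ∈ unitI) : uIcc a b ⊆ unitI :=
  (convex_Icc (0 : ℝ) 1).ordConnected.uIcc_subset ha hb

theorem intervalIntegrable_of_continuousOn_unitI {φ : ℝ → ℝ} (hφ : ContinuousOn φ unitI) {a b : ℝ}
    (ha : a ∈ unitI) (hb : b ∈ unitI) : IntervalIntegrable φ volume a b :=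
  (hφ.mono (uIcc_subset_unitI ha hb)).intervalIntegrable

theorem hFun_eq (f : ℝ → ℝ) (x y : ℝ) :
    hFun f f x y = 3 * f x * f y + scaledDeriv f x * f y + scaledDeriv f y * f x := rfl

theorem hFun_comm (f : ℝ → ℝ) (x y : ℝ) : hFun f f x y = hFun f f y x := by
  simp only [hFun_eq]; ring

theorem distr_zero (f : ℝ → ℝ) : distr f 0 = 0 := by simp [distr]

theorem etaFun_zero (f : ℝ → ℝ) : etaFun f 0 = 0 := by simp [etaFun]

theorem gFun_zero (f : ℝ → ℝ) : gFun f 0 = 0 := by simp [gFun]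

namespace Admissible

variable {f : ℝ → ℝ} (A : Admissible f)
include A

theorem pos {t : ℝ} (ht : t ∈ unitI) : 0 < f t := A.isDensity.pos t ht

theorem continuousOn : ContinuousOn f unitI := A.differentiableOn.continuousOn

theorem hasDerivAt {t : ℝ} (ht : t ∈ Ioo (0 : ℝ) 1) : HasDerivAt f (dens' f t) t :=
  (A.differentiableOn t (Ioo_subset_Icc_self ht)).hasDerivWithinAt.hasDerivAt
    (Icc_mem_nhds ht.1 ht.2)

theorem scaledDeriv_eq {t : ℝ} (ht : t ∈ unitI) : scaledDeriv f t = etaFun f t * f t := by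
  rw [etaFun, scaledDeriv, div_mul_cancel₀ _ (A.pos ht).ne']

theorem scaledDeriv_continuousOn : ContinuousOn (scaledDeriv f) unitI :=
  (A.etaFun_differentiableOn.continuousOn.mul A.continuousOn).congr fun _ ht =>
    A.scaledDeriv_eq ht

theorem distr_one : distr f 1 = 1 := A.isDensity.integral_eq_one

theorem tail_eq {q : ℝ} (hq : q ∈ unitI) : 1 - distr f q = ∫ t in q..1, f t := by
  have := intervalIntegral.integral_add_adjacent_intervals
      (intervalIntegrable_of_continuousOn_unitI A.continuousOn zero_mem_unitI hq)
      (intervalIntegrable_of_continuousOn_unitI A.continuousOn hq one_mem_unitI)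
  rw [A.isDensity.integral_eq_one] at this
  rw [distr]
  linarith

theorem distr_sub {p q : ℝ} (hp : p ∈ unitI) (hq : q ∈ unitI) :
    distr f q - distr f p = ∫ t in p..q, f t := by
  rw [distr, distr, sub_eq_iff_eq_add, add_comm,
    intervalIntegral.integral_add_adjacent_intervals
      (intervalIntegrable_of_continuousOn_unitI A.continuousOn zero_mem_unitI hp)
      (intervalIntegrable_of_continuousOn_unitI A.continuousOn hp hq)]

theorem distr_strictMonoOn : StrictMonoOn (distr f) unitI := by
  intro p hp q hq hpq
  rw [← sub_pos, A.distr_sub hp hq]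
  exact intervalIntegral.intervalIntegral_pos_of_pos_on
    (intervalIntegrable_of_continuousOn_unitI A.continuousOn hp hq)
    (fun t ht => A.pos ⟨hp.1.trans ht.1.le, ht.2.le.trans hq.2⟩) hpq

theorem tail_pos {t : ℝ} (ht : t ∈ Ico (0 : ℝ) 1) : 0 < 1 - distr f t := by
  have := A.distr_strictMonoOn ⟨ht.1, ht.2.le⟩ one_mem_unitI ht.2
  rw [A.distr_one] at this; linarith

theorem tail_nonneg {t : ℝ} (ht : t ∈ unitI) : 0 ≤ 1 - distr f t := by
  have := A.distr_strictMonoOn.monotoneOn ht one_mem_unitI ht.2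
  rw [A.distr_one] at this; linarith

theorem distr_continuousOn : ContinuousOn (distr f) unitI := by
  have := intervalIntegral.continuousOn_primitive_interval
    (μ := volume) (f := f) (a := 0) (b := 1)
    (by rw [uIcc_of_le zero_le_one]; exact A.continuousOn.integrableOn_compact isCompact_Icc)
  rwa [uIcc_of_le zero_le_one] at this

theorem integral_add_scaledDeriv {q : ℝ} (hq : q ∈ unitI) :
    ∫ t in q..1, (f t + scaledDeriv f t) = f 1 - q * f q := by
  have hsub : Icc q 1 ⊆ unitI := Icc_subset_Icc_left hq.1
  have key := intervalIntegral.integral_eq_sub_of_hasDerivAt_of_le (f := fun t => t * f t)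
    (f' := fun t => f t + scaledDeriv f t) hq.2
    ((continuousOn_id.mul A.continuousOn).mono hsub)
    (fun t ht => by
      have := (hasDerivAt_id t).mul (A.hasDerivAt ⟨hq.1.trans_lt ht.1, ht.2⟩)
      simpa only [id_eq, one_mul, scaledDeriv, Pi.mul_def] using this)
    (intervalIntegrable_of_continuousOn_unitI
      (A.continuousOn.add A.scaledDeriv_continuousOn) hq one_mem_unitI)
  simpa using key

theorem integral_scaledDeriv {q : ℝ} (hq : q ∈ unitI) :
    ∫ t in q..1, scaledDeriv f t = f 1 - q * f q - (1 - distr f q) := by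
  have h1 := A.integral_add_scaledDeriv hq
  rw [intervalIntegral.integral_add
    (intervalIntegrable_of_continuousOn_unitI A.continuousOn hq one_mem_unitI)
    (intervalIntegrable_of_continuousOn_unitI A.scaledDeriv_continuousOn hq one_mem_unitI),
    ← A.tail_eq hq] at h1
  linarith

/-- Integrating `x f'(x)` by parts produces the boundary term `f(1) f(a)`, which is the edge mass at
height `a`; `excess` collects what remains. -/
theorem integral_hFun {a q : ℝ} (hq : q ∈ unitI) :
    ∫ x in q..1, hFun f f x a = f 1 * f a + excess f a q := by
  have i1 := intervalIntegrable_of_continuousOn_unitI A.continuousOn hq one_mem_unitI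
  have i2 := intervalIntegrable_of_continuousOn_unitI A.scaledDeriv_continuousOn hq one_mem_unitI
  have : ∀ x, hFun f f x a = (3 * f a + scaledDeriv f a) * f x + f a * scaledDeriv f x := by
    intro x; rw [hFun_eq]; ring
  simp only [this]
  rw [intervalIntegral.integral_add (i1.const_mul _) (i2.const_mul _),
    intervalIntegral.integral_const_mul, intervalIntegral.integral_const_mul,
    A.integral_scaledDeriv hq, ← A.tail_eq hq, excess]
  ring

theorem hFun_continuousOn : ContinuousOn (fun x : ℝ × ℝ => hFun f f x.1 x.2) square := by
  have h1 : ContinuousOn (fun x : ℝ × ℝ => f x.1) square :=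
    A.continuousOn.comp continuousOn_fst fun x hx => hx.1
  have h2 : ContinuousOn (fun x : ℝ × ℝ => f x.2) square :=
    A.continuousOn.comp continuousOn_snd fun x hx => hx.2
  have h3 : ContinuousOn (fun x : ℝ × ℝ => scaledDeriv f x.1) square :=
    A.scaledDeriv_continuousOn.comp continuousOn_fst fun x hx => hx.1
  have h4 : ContinuousOn (fun x : ℝ × ℝ => scaledDeriv f x.2) square :=
    A.scaledDeriv_continuousOn.comp continuousOn_snd fun x hx => hx.2
  simp only [hFun_eq]
  exact (((continuousOn_const.mul h1).mul h2).add (h3.mul h2)).add (h4.mul h1)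

theorem hFun_pos {x y : ℝ} (hx : x ∈ unitI) (hy : y ∈ unitI) : 0 < hFun f f x y := by
  have h1 := A.regular.nonneg₁ x hx y hy
  have := mul_pos (A.pos one_mem_unitI) (A.pos hx)
  linarith

theorem etaFun_nonpos {t : ℝ} (ht : t ∈ unitI) : etaFun f t ≤ 0 := by
  rw [← etaFun_zero f]; exact A.etaFun_antitoneOn zero_mem_unitI ht ht.1

/-- At the corner `(1, 1)` regularity reads `2 f(1)² (1 + H(1)) ≥ 0`. -/
theorem neg_one_le_etaFun_one : -1 ≤ etaFun f 1 := by
  have h1 := A.regular.nonneg₁ 1 one_mem_unitI 1 one_mem_unitI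
  rw [hFun_eq, A.scaledDeriv_eq one_mem_unitI] at h1
  have hp := A.pos one_mem_unitI
  have : 0 ≤ 2 * (f 1 * f 1) * (1 + etaFun f 1) := by linarith
  have := nonneg_of_mul_nonneg_right this (by positivity)
  linarith

theorem neg_one_le_etaFun {t : ℝ} (ht : t ∈ unitI) : -1 ≤ etaFun f t :=
  A.neg_one_le_etaFun_one.trans (A.etaFun_antitoneOn ht one_mem_unitI ht.2)

theorem dens'_eq {t : ℝ} (ht : t ∈ Ioo (0 : ℝ) 1) : dens' f t = etaFun f t * f t / t := by
  rw [← A.scaledDeriv_eq (Ioo_subset_Icc_self ht), scaledDeriv, mul_div_cancel_left₀ _ ht.1.ne']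

/-- On `(0,1)` the sign of `f'` is that of `H`, and `H ≤ H(0) = 0`. -/
theorem antitoneOn : AntitoneOn f unitI := by
  refine antitoneOn_of_deriv_nonpos (convex_Icc 0 1) A.continuousOn ?_ ?_
  · exact A.differentiableOn.mono interior_subset
  · intro t ht
    replace ht : t ∈ Ioo (0 : ℝ) 1 := by rwa [← interior_Icc]
    rw [(A.hasDerivAt ht).deriv, A.dens'_eq ht]
    exact div_nonpos_of_nonpos_of_nonneg (mul_nonpos_of_nonpos_of_nonneg
      (A.etaFun_nonpos (Ioo_subset_Icc_self ht)) (A.pos (Ioo_subset_Icc_self ht)).le) ht.1.le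

theorem tail_le {t : ℝ} (ht : t ∈ unitI) : 1 - distr f t ≤ (1 - t) * f t := by
  rw [A.tail_eq ht]
  calc ∫ x in t..1, f x ≤ ∫ x in t..1, f t := by
        refine intervalIntegral.integral_mono_on ht.2
          (intervalIntegrable_of_continuousOn_unitI A.continuousOn ht one_mem_unitI) (by simp) ?_
        intro x hx
        exact A.antitoneOn ht ⟨ht.1.trans hx.1, hx.2⟩ hx.1
    _ = _ := by simp

/-- Negative `H` makes `f` strictly decreasing beyond `s`. The strictness is what makes the bound
`s' > -1` strict. -/
theorem tail_lt {s : ℝ} (hs : s ∈ Ico (0 : ℝ) 1) (hneg : ∀ t ∈ Ioo s 1, etaFun f t < 0) :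
    1 - distr f s < (1 - s) * f s := by
  have hs' : s ∈ unitI := ⟨hs.1, hs.2.le⟩
  have hanti : StrictAntiOn f (Icc s 1) := by
    refine strictAntiOn_of_deriv_neg (convex_Icc s 1)
      (A.continuousOn.mono (Icc_subset_Icc_left hs.1)) ?_
    intro t ht
    rw [interior_Icc] at ht
    have ht' : t ∈ Ioo (0 : ℝ) 1 := ⟨hs.1.trans_lt ht.1, ht.2⟩
    rw [(A.hasDerivAt ht').deriv, A.dens'_eq ht']
    exact div_neg_of_neg_of_pos
      (mul_neg_of_neg_of_pos (hneg t ht) (A.pos (Ioo_subset_Icc_self ht'))) ht'.1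
  rw [A.tail_eq hs']
  calc ∫ x in s..1, f x < ∫ x in s..1, f s := by
        refine intervalIntegral.integral_lt_integral_of_continuousOn_of_le_of_exists_lt hs.2
          (A.continuousOn.mono (Icc_subset_Icc_left hs.1)) continuousOn_const ?_ ?_
        · intro x hx
          exact A.antitoneOn hs' ⟨hs.1.trans hx.1.le, hx.2⟩ hx.1.le
        · exact ⟨1, ⟨hs.2.le, le_rfl⟩, hanti ⟨le_rfl, hs.2.le⟩ ⟨hs.2.le, le_rfl⟩ hs.2⟩
    _ = _ := by simp

theorem gFun_mul_tail {t : ℝ} (ht : t ∈ Ico (0 : ℝ) 1) :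
    gFun f t * (1 - distr f t) = t * f t := by
  rw [gFun, div_mul_cancel₀ _ (A.tail_pos ht).ne']

/-- A decreasing density has tail at most `(1 - t) f(t)`. Hence `G` is unbounded near `1`. -/
theorem div_le_gFun {t : ℝ} (ht : t ∈ Ico (0 : ℝ) 1) : t / (1 - t) ≤ gFun f t := by
  have h1 : 0 < 1 - t := by linarith [ht.2]
  rw [gFun, div_le_div_iff₀ h1 (A.tail_pos ht)]
  have := mul_le_mul_of_nonneg_left (A.tail_le ⟨ht.1, ht.2.le⟩) ht.1
  linarith

/-- The factorization shows where the curve comes from: the sign is that of `2 + H(a) - G(q)`, which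
changes at `q = s(a)`. -/
theorem excess_eq {a q : ℝ} (ha : a ∈ unitI) (hq : q ∈ Ico (0 : ℝ) 1) :
    excess f a q = f a * (1 - distr f q) * (2 + etaFun f a - gFun f q) := by
  rw [excess, A.scaledDeriv_eq ha]
  linear_combination f a * A.gFun_mul_tail hq

end Admissible

/-! ### The inverse of `G` and the shape of the curve `s`. -/

/-- The inverse of `G` on `[0,1)`. -/
def gInv (f : ℝ → ℝ) (y : ℝ) : ℝ := Function.invFunOn (gFun f) (Ico 0 1) y

namespace Admissible

variable {f : ℝ → ℝ} (A : Admissible f)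
include A

theorem exists_gFun_eq {y : ℝ} (hy : 0 ≤ y) : ∃ t ∈ Ico (0 : ℝ) 1, gFun f t = y := by
  -- This point solves `t / (1 - t) = y`, so `G` is at least `y` there and the intermediate value
  -- theorem applies on `[0, y / (1 + y)]`.
  have ht : y / (1 + y) ∈ Ico (0 : ℝ) 1 :=
    ⟨by positivity, by rw [div_lt_one (by positivity)]; linarith⟩
  have hle : y ≤ gFun f (y / (1 + y)) := by
    refine le_trans (le_of_eq ?_) (A.div_le_gFun ht)
    field_simp
    ring
  have hsub : Icc 0 (y / (1 + y)) ⊆ Ico (0 : ℝ) 1 := fun x hx => ⟨hx.1, hx.2.trans_lt ht.2⟩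
  obtain ⟨t, ht', h⟩ := intermediate_value_Icc ht.1
    (A.gFun_differentiableOn.continuousOn.mono hsub) (by rw [gFun_zero]; exact ⟨hy, hle⟩)
  exact ⟨t, hsub ht', h⟩

theorem gInv_mem {y : ℝ} (hy : 0 ≤ y) : gInv f y ∈ Ico (0 : ℝ) 1 :=
  Function.invFunOn_mem (A.exists_gFun_eq hy)

theorem gFun_gInv {y : ℝ} (hy : 0 ≤ y) : gFun f (gInv f y) = y :=
  Function.invFunOn_eq (A.exists_gFun_eq hy)

theorem gInv_pos {y : ℝ} (hy : 0 < y) : 0 < gInv f y := by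
  refine (A.gInv_mem hy.le).1.lt_of_ne fun h => ?_
  have := A.gFun_gInv hy.le
  rw [← h, gFun_zero] at this
  exact hy.ne this

theorem le_gInv {t y : ℝ} (hy : 0 ≤ y) (ht : t ∈ Ico (0 : ℝ) 1) (h : gFun f t ≤ y) :
    t ≤ gInv f y := by
  rw [← A.gFun_gInv hy] at h
  exact (A.gFun_strictMonoOn.le_iff_le ht (A.gInv_mem hy)).1 h

theorem gInv_monotoneOn : MonotoneOn (gInv f) (Ici 0) := fun _ hx _ hy hxy =>
  A.le_gInv hy (A.gInv_mem hx) ((A.gFun_gInv hx).trans_le hxy)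

/-- The inverse of an increasing convex function is concave. Continuity of the inverse on `(0, ∞)`
is then automatic. -/
theorem gInv_concaveOn : ConcaveOn ℝ (Ici 0) (gInv f) := by
  refine ⟨convex_Ici 0, fun x hx y hy a b ha hb hab => ?_⟩
  refine A.le_gInv (convex_Ici (0 : ℝ) hx hy ha hb hab)
    (convex_Ico (0 : ℝ) 1 (A.gInv_mem hx) (A.gInv_mem hy) ha hb hab) ?_
  have := A.gFun_convexOn.2 (A.gInv_mem hx) (A.gInv_mem hy) ha hb hab
  rwa [A.gFun_gInv hx, A.gFun_gInv hy] at this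

theorem gInv_continuousAt {y : ℝ} (hy : 0 < y) : ContinuousAt (gInv f) y := by
  have := A.gInv_concaveOn.continuousOn_interior
  rw [interior_Ici] at this
  exact this.continuousAt (Ioi_mem_nhds hy)

theorem gFun_hasDerivAt {t : ℝ} (ht : t ∈ Ioo (0 : ℝ) 1) :
    HasDerivAt (gFun f) (deriv (gFun f) t) t :=
  ((A.gFun_differentiableOn t ⟨ht.1.le, ht.2⟩).differentiableAt
    (Ico_mem_nhds ht.1 ht.2)).hasDerivAt

/-- By convexity the slope at `t` dominates the chord from the origin, as `G(0) = 0`. This makes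
`G'` nonzero and bounds `|s'|` from above. -/
theorem gFun_div_le_deriv {t : ℝ} (ht : t ∈ Ioo (0 : ℝ) 1) :
    gFun f t / t ≤ deriv (gFun f) t := by
  have := A.gFun_convexOn.slope_le_of_hasDerivAt ⟨le_rfl, zero_lt_one⟩ ⟨ht.1.le, ht.2⟩ ht.1
    (A.gFun_hasDerivAt ht)
  simpa [slope_def_field, gFun_zero] using this

theorem gFun_pos {t : ℝ} (ht : t ∈ Ioo (0 : ℝ) 1) : 0 < gFun f t := by
  have := A.gFun_strictMonoOn ⟨le_rfl, zero_lt_one⟩ ⟨ht.1.le, ht.2⟩ ht.1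
  rwa [gFun_zero] at this

theorem gInv_hasDerivAt {y : ℝ} (hy : 0 < y) :
    HasDerivAt (gInv f) (deriv (gFun f) (gInv f y))⁻¹ y := by
  have hm : gInv f y ∈ Ioo (0 : ℝ) 1 := ⟨A.gInv_pos hy, (A.gInv_mem hy.le).2⟩
  refine (A.gFun_hasDerivAt hm).of_local_left_inverse (A.gInv_continuousAt hy) ?_ ?_
  · have := A.gFun_div_le_deriv hm
    exact ((div_pos (A.gFun_pos hm) hm.1).trans_le this).ne'
  · filter_upwards [Ioi_mem_nhds hy] with x hx using A.gFun_gInv (le_of_lt hx)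

theorem two_add_etaFun_pos {t : ℝ} (ht : t ∈ unitI) : 0 < 2 + etaFun f t := by
  linarith [A.neg_one_le_etaFun ht]

theorem sFun_mem {t : ℝ} (ht : t ∈ unitI) : sFun f t ∈ Ioo (0 : ℝ) 1 :=
  ⟨A.gInv_pos (A.two_add_etaFun_pos ht), (A.gInv_mem (A.two_add_etaFun_pos ht).le).2⟩

theorem sFun_mem_unitI {t : ℝ} (ht : t ∈ unitI) : sFun f t ∈ unitI :=
  Ioo_subset_Icc_self (A.sFun_mem ht)

theorem sFun_mem_Ico {t : ℝ} (ht : t ∈ unitI) : sFun f t ∈ Ico (0 : ℝ) 1 :=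
  Ioo_subset_Ico_self (A.sFun_mem ht)

theorem gFun_sFun {t : ℝ} (ht : t ∈ unitI) : gFun f (sFun f t) = 2 + etaFun f t :=
  A.gFun_gInv (A.two_add_etaFun_pos ht).le

theorem sFun_antitoneOn : AntitoneOn (sFun f) unitI := fun x hx y hy hxy =>
  A.gInv_monotoneOn (A.two_add_etaFun_pos hy).le (A.two_add_etaFun_pos hx).le
    (by linarith [A.etaFun_antitoneOn hx hy hxy])

theorem sFun_concaveOn : ConcaveOn ℝ unitI (sFun f) := by
  refine ⟨convex_Icc 0 1, fun x hx y hy a b ha hb hab => ?_⟩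
  have h1 := A.gInv_concaveOn.2 (A.two_add_etaFun_pos hx).le (A.two_add_etaFun_pos hy).le ha hb hab
  refine h1.trans (A.gInv_monotoneOn ?_ ?_ ?_)
  · exact convex_Ici (0 : ℝ) (A.two_add_etaFun_pos hx).le (A.two_add_etaFun_pos hy).le ha hb hab
  · exact (A.two_add_etaFun_pos (convex_Icc (0 : ℝ) 1 hx hy ha hb hab)).le
  · have h2 := A.etaFun_concaveOn.2 hx hy ha hb hab
    simp only [smul_eq_mul] at h2 ⊢
    have : a * (2 + etaFun f x) + b * (2 + etaFun f y)
      = 2 * (a + b) + (a * etaFun f x + b * etaFun f y) := by ring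
    rw [this, hab]
    linarith

theorem sFun_hasDerivWithinAt {t : ℝ} (ht : t ∈ unitI) :
    HasDerivWithinAt (sFun f)
      ((deriv (gFun f) (sFun f t))⁻¹ * derivWithin (etaFun f) unitI t) unitI t := by
  have h1 : HasDerivWithinAt (fun t => 2 + etaFun f t) (derivWithin (etaFun f) unitI t) unitI t :=
    (A.etaFun_differentiableOn t ht).hasDerivWithinAt.const_add 2
  exact (A.gInv_hasDerivAt (A.two_add_etaFun_pos ht)).comp_hasDerivWithinAt t h1

theorem sFun_differentiableOn : DifferentiableOn ℝ (sFun f) unitI := fun _ ht =>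
  (A.sFun_hasDerivWithinAt ht).differentiableWithinAt

theorem sFun_continuousOn : ContinuousOn (sFun f) unitI := A.sFun_differentiableOn.continuousOn

theorem derivWithin_etaFun_ge {t x : ℝ} (ht : t ∈ unitI) (hx : x ∈ unitI) (htx : t < x) :
    etaFun f x ≤ etaFun f t + derivWithin (etaFun f) unitI t * (x - t) := by
  have h := A.etaFun_concaveOn.slope_le_of_hasDerivWithinAt ht hx htx
    (A.etaFun_differentiableOn t ht).hasDerivWithinAt
  rw [slope_def_field, div_le_iff₀ (sub_pos.2 htx)] at h
  linarith

/-- Write `s` for `s(t)`. If `s'(t) = H'(t) / G'(s) ≤ -1`, the chord bound forces `H'(t) ≤ -(2 +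
H(t)) / s`. The strict tail bound gives `s < (2 + H(t)) (1 - s)`, so with `t ≤ s` we get `H'(t) (1 -
t) < -1`. Concavity of `H` then yields `H(1) < H(t) - 1 ≤ -1`, against `H(1) ≥ -1`. -/
theorem neg_one_lt_derivWithin_sFun {t : ℝ} (ht : t ∈ unitI) (hts : t ≤ sFun f t) :
    -1 < derivWithin (sFun f) unitI t := by
  have hs := A.sFun_mem ht
  have ht1 : t < 1 := hts.trans_lt hs.2
  rw [(A.sFun_hasDerivWithinAt ht).derivWithin (uniqueDiffOn_Icc zero_lt_one t ht)]
  set s := sFun f t with hsdef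
  set d := derivWithin (etaFun f) unitI t with hd
  have hG := A.gFun_div_le_deriv hs
  rw [A.gFun_sFun ht] at hG
  have hE := A.two_add_etaFun_pos ht
  have hG0 : 0 < deriv (gFun f) s := (div_pos hE hs.1).trans_le hG
  by_contra! hcon
  rw [inv_mul_le_iff₀ hG0] at hcon
  have hd' : d ≤ -((2 + etaFun f t) / s) := by linarith
  have hdneg : d < 0 := hd'.trans_lt (neg_neg_of_pos (div_pos hE hs.1))
  have h1 : -1 ≤ etaFun f t + d * (1 - t) :=
    A.neg_one_le_etaFun_one.trans (A.derivWithin_etaFun_ge ht one_mem_unitI ht1)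
  have htail : 1 - distr f s < (1 - s) * f s := by
    refine A.tail_lt ⟨hs.1.le, hs.2⟩ fun x hx => ?_
    have hx' : x ∈ unitI := ⟨hs.1.le.trans hx.1.le, hx.2.le⟩
    have := A.derivWithin_etaFun_ge ht hx' (hts.trans_lt hx.1)
    have h2 := A.etaFun_nonpos ht
    have h3 : d * (x - t) < 0 := mul_neg_of_neg_of_pos hdneg (sub_pos.2 (hts.trans_lt hx.1))
    linarith
  have hprod := A.gFun_mul_tail ⟨hs.1.le, hs.2⟩
  rw [A.gFun_sFun ht] at hprod
  have hfs : 0 < f s := A.pos ⟨hs.1.le, hs.2.le⟩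
  have h4 : s < (2 + etaFun f t) * (1 - s) := by
    have : s * f s < (2 + etaFun f t) * (1 - s) * f s := by
      rw [← hprod, mul_assoc]; exact mul_lt_mul_of_pos_left htail hE
    exact lt_of_mul_lt_mul_right this hfs.le
  have h5 : d * (1 - t) ≤ -((2 + etaFun f t) / s) * (1 - s) :=
    calc d * (1 - t) ≤ d * (1 - s) := mul_le_mul_of_nonpos_left (by linarith) hdneg.le
      _ ≤ _ := mul_le_mul_of_nonneg_right hd' (by linarith [hs.2])
  have h6 : 1 < (2 + etaFun f t) / s * (1 - s) := by
    rw [div_mul_eq_mul_div, one_lt_div hs.1]; exact h4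
  linarith [A.etaFun_nonpos ht]

/-- From `s / (1 - s) ≤ G(s) = 2` at `s = s(0)`. -/
theorem sFun_zero_le : sFun f 0 ≤ 2 / 3 := by
  have hs := A.sFun_mem zero_mem_unitI
  have h := A.div_le_gFun (Ioo_subset_Ico_self hs)
  rw [A.gFun_sFun zero_mem_unitI, etaFun_zero, div_le_iff₀ (by linarith [hs.2])] at h
  linarith

/-- Convexity halves `G` at least: `G(s(0) / 2) ≤ G(s(0)) / 2 = 1 ≤ 2 + H(1)`. -/
theorem half_sFun_zero_le : sFun f 0 / 2 ≤ sFun f 1 := by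
  have hs := A.sFun_mem zero_mem_unitI
  refine A.le_gInv (A.two_add_etaFun_pos one_mem_unitI).le
    ⟨by linarith [hs.1], by linarith [hs.1, hs.2]⟩ ?_
  have h := A.gFun_convexOn.2 (⟨le_rfl, zero_lt_one⟩ : (0 : ℝ) ∈ Ico (0 : ℝ) 1)
    (Ioo_subset_Ico_self hs) (show (0 : ℝ) ≤ 1 / 2 by norm_num)
    (show (0 : ℝ) ≤ 1 / 2 by norm_num) (by norm_num)
  rw [A.gFun_sFun zero_mem_unitI, etaFun_zero, gFun_zero] at h
  simp only [smul_eq_mul] at h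
  have h2 : (1 / 2 : ℝ) * 0 + 1 / 2 * sFun f 0 = sFun f 0 / 2 := by ring
  rw [h2] at h
  linarith [A.neg_one_le_etaFun_one]

/-- A concave function on `[z, 1]` is at least the smaller of its end values, and `z + s(z) ≤ 2 s(0)
≤ 1 + s(0) / 2 ≤ 1 + s(1)`. The price is allowed to be smaller than `z + s(z)` because bundling
takes `z = 0` and `p ≤ s(0)`. -/
theorem le_add_sFun {p z t : ℝ} (hz : z ∈ Icc 0 (sFun f 0)) (hp : p ≤ z + sFun f z)
    (ht : t ∈ Icc z 1) : p ≤ t + sFun f t := by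
  have h0 := A.sFun_zero_le
  have h1 := A.half_sFun_zero_le
  have hzI : z ∈ unitI := ⟨hz.1, by linarith [hz.2]⟩
  have hconc : ConcaveOn ℝ unitI (fun t => t + sFun f t) :=
    (concaveOn_id (convex_Icc 0 1)).add A.sFun_concaveOn
  have := hconc.min_le_of_mem_Icc hzI one_mem_unitI ht
  refine le_trans (le_min hp ?_) this
  have := A.sFun_antitoneOn zero_mem_unitI hzI hz.1
  linarith [hz.2]

/-- Since `s` decreases, `t ≤ s(t)` persists to the left of `z`, and there `s' > -1`. -/
theorem add_sFun_strictMonoOn {z : ℝ} (hz : z ∈ unitI) (hzs : z ≤ sFun f z) :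
    StrictMonoOn (fun t => t + sFun f t) (Icc 0 z) := by
  have hsub : Icc 0 z ⊆ unitI := Icc_subset_Icc_right hz.2
  refine strictMonoOn_of_deriv_pos (convex_Icc 0 z)
    (continuousOn_id.add (A.sFun_continuousOn.mono hsub)) fun t ht => ?_
  rw [interior_Icc] at ht
  have htI : t ∈ unitI := ⟨ht.1.le, ht.2.le.trans hz.2⟩
  have hnhds : unitI ∈ 𝓝 t := Icc_mem_nhds ht.1 (ht.2.trans_le hz.2)
  have hts : t ≤ sFun f t := ht.2.le.trans (hzs.trans (A.sFun_antitoneOn htI hz ht.2.le))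
  have hd := A.neg_one_lt_derivWithin_sFun htI hts
  have h1 : HasDerivAt (sFun f) (derivWithin (sFun f) unitI t) t :=
    (A.sFun_differentiableOn t htI).hasDerivWithinAt.hasDerivAt hnhds
  have h2 := (hasDerivAt_id' t).add h1
  have h3 : deriv (fun t => t + sFun f t) t = 1 + derivWithin (sFun f) unitI t := h2.deriv
  rw [h3]
  linarith

theorem add_sFun_le {z t : ℝ} (hz : z ∈ unitI) (hzs : z ≤ sFun f z) (ht : t ∈ Icc 0 z) :
    t + sFun f t ≤ z + sFun f z :=
  (A.add_sFun_strictMonoOn hz hzs).monotoneOn ht ⟨hz.1, le_rfl⟩ ht.2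

theorem excess_sFun {a : ℝ} (ha : a ∈ unitI) : excess f a (sFun f a) = 0 := by
  rw [A.excess_eq ha (A.sFun_mem_Ico ha), A.gFun_sFun ha]; ring

theorem excess_nonneg {a q : ℝ} (ha : a ∈ unitI) (hq : 0 ≤ q) (hqs : q ≤ sFun f a) :
    0 ≤ excess f a q := by
  have hq' : q ∈ Ico (0 : ℝ) 1 := ⟨hq, hqs.trans_lt (A.sFun_mem ha).2⟩
  rw [A.excess_eq ha hq']
  refine mul_nonneg (mul_nonneg (A.pos ha).le (A.tail_pos hq').le) ?_
  have := A.gFun_strictMonoOn.monotoneOn hq' (A.sFun_mem_Ico ha) hqs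
  rw [A.gFun_sFun ha] at this
  linarith

end Admissible

/-! ### Mass balance of corner regions. -/

/-- The part of the square above the corner `(a, b)` and the line `x₁ + x₂ = p`. -/
def region (p a b : ℝ) : Set (ℝ × ℝ) :=
  {x | x ∈ square ∧ a ≤ x.1 ∧ b ≤ x.2 ∧ p ≤ x.1 + x.2}

/-- The deficiency of `region p a b`: the `h`-mass of the region minus the mass that its
upper right edges carry. -/
def deficiency (f : ℝ → ℝ) (p a b : ℝ) : ℝ :=
  (∫ x in region p a b, hFun f f x.1 x.2) - f 1 * ((1 - distr f a) + (1 - distr f b))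

theorem isCompact_square : IsCompact square := isCompact_Icc.prod isCompact_Icc

theorem measurableSet_square : MeasurableSet square := isCompact_square.measurableSet

theorem region_subset_square (p a b : ℝ) : region p a b ⊆ square := fun _ hx => hx.1

theorem measurableSet_region (p a b : ℝ) : MeasurableSet (region p a b) := by
  have h1 : MeasurableSet {x : ℝ × ℝ | a ≤ x.1} := measurableSet_le measurable_const measurable_fst
  have h2 : MeasurableSet {x : ℝ × ℝ | b ≤ x.2} := measurableSet_le measurable_const measurable_snd
  have h3 : MeasurableSet {x : ℝ × ℝ | p ≤ x.1 + x.2} :=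
    measurableSet_le measurable_const (measurable_fst.add measurable_snd)
  exact measurableSet_square.inter (h1.inter (h2.inter h3))

theorem setIntegral_swap (φ : ℝ × ℝ → ℝ) (S : Set (ℝ × ℝ)) :
    ∫ x in Prod.swap ⁻¹' S, φ x.swap = ∫ x in S, φ x :=
  (Measure.measurePreserving_swap (μ := (volume : Measure ℝ)) (ν := (volume : Measure ℝ))
    ).setIntegral_preimage_emb MeasurableEquiv.prodComm.measurableEmbedding φ S

/-- Fubini for sets whose horizontal slices reach the right edge. The slice description is required
only on the open interval, since the two extreme slices are null. -/
theorem setIntegral_slices {S : Set (ℝ × ℝ)} (hS : MeasurableSet S) (hSq : S ⊆ square)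
    {φ : ℝ × ℝ → ℝ} (hφ : IntegrableOn φ square) {c d : ℝ} (hcd : c ≤ d) {lo : ℝ → ℝ}
    (hlo : ∀ t ∈ Ioo c d, lo t ≤ 1)
    (hmem : ∀ t ∈ Ioo c d, ∀ x, (x, t) ∈ S ↔ x ∈ Icc (lo t) 1)
    (hout : ∀ x ∈ S, x.2 ∈ Icc c d) :
    ∫ x in S, φ x = ∫ t in c..d, ∫ x in lo t..1, φ (x, t) := by
  have hint : Integrable (S.indicator φ) := (hφ.mono_set hSq).integrable_indicator hS
  rw [← integral_indicator hS, Measure.volume_eq_prod, integral_prod_symm _ hint,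
    intervalIntegral.integral_of_le hcd, integral_Ioc_eq_integral_Ioo,
    ← setIntegral_eq_integral_of_forall_compl_eq_zero (s := Icc c d),
    integral_Icc_eq_integral_Ioo]
  · refine setIntegral_congr_fun measurableSet_Ioo fun t ht => ?_
    have : (fun x => S.indicator φ (x, t)) = (Icc (lo t) 1).indicator fun x => φ (x, t) := by
      funext x
      by_cases hx : (x, t) ∈ S
      · rw [indicator_of_mem hx, indicator_of_mem ((hmem t ht x).1 hx)]
      · rw [indicator_of_notMem hx, indicator_of_notMem (fun h => hx ((hmem t ht x).2 h))]
    simp only [this]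
    rw [integral_indicator measurableSet_Icc, intervalIntegral.integral_of_le (hlo t ht),
      integral_Icc_eq_integral_Ioc]
  · intro t ht
    have : (fun x => S.indicator φ (x, t)) = fun _ => 0 := by
      funext x
      exact indicator_of_notMem (fun hx => ht (hout _ hx)) _
    simp [this]

theorem deficiency_comm (f : ℝ → ℝ) (p a b : ℝ) : deficiency f p a b = deficiency f p b a := by
  have : Prod.swap ⁻¹' region p b a = region p a b := by
    ext x
    simp only [region, mem_preimage, mem_ofPred_eq, square, mem_prod, Prod.fst_swap, Prod.snd_swap]
    rw [add_comm x.2 x.1]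
    tauto
  rw [deficiency, deficiency, ← setIntegral_swap (fun x => hFun f f x.1 x.2) (region p b a), this,
    add_comm (1 - distr f b)]
  simp only [Prod.fst_swap, Prod.snd_swap]
  simp_rw [fun x : ℝ × ℝ => hFun_comm f x.2 x.1]

namespace Admissible

variable {f : ℝ → ℝ} (A : Admissible f)
include A

theorem hFun_integrableOn : IntegrableOn (fun x : ℝ × ℝ => hFun f f x.1 x.2) square :=
  A.hFun_continuousOn.integrableOn_compact isCompact_square

theorem excess_continuousOn : ContinuousOn (fun x : ℝ × ℝ => excess f x.1 x.2) square := by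
  have h1 : ContinuousOn (fun x : ℝ × ℝ => f x.1) square :=
    A.continuousOn.comp continuousOn_fst fun x hx => hx.1
  have h2 : ContinuousOn (fun x : ℝ × ℝ => f x.2) square :=
    A.continuousOn.comp continuousOn_snd fun x hx => hx.2
  have h3 : ContinuousOn (fun x : ℝ × ℝ => scaledDeriv f x.1) square :=
    A.scaledDeriv_continuousOn.comp continuousOn_fst fun x hx => hx.1
  have h4 : ContinuousOn (fun x : ℝ × ℝ => distr f x.2) square :=
    A.distr_continuousOn.comp continuousOn_snd fun x hx => hx.2
  exact (((continuousOn_const.mul h1).add h3).mul (continuousOn_const.sub h4)).sub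
    ((continuousOn_snd.mul h2).mul h1)

theorem excess_sub {a q r : ℝ} (hq : q ∈ unitI) (hr : r ∈ unitI) (ha : a ∈ unitI) :
    excess f a q - excess f a r = ∫ x in q..r, hFun f f x a := by
  have hc : ContinuousOn (fun x => hFun f f x a) unitI :=
    A.hFun_continuousOn.comp (f := fun x : ℝ => (x, a)) (by fun_prop) fun x hx => ⟨hx, ha⟩
  have h := intervalIntegral.integral_add_adjacent_intervals
    (intervalIntegrable_of_continuousOn_unitI hc hq hr)
    (intervalIntegrable_of_continuousOn_unitI hc hr one_mem_unitI)
  rw [A.integral_hFun hq, A.integral_hFun hr] at h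
  linarith

theorem excess_strictAntiOn {a : ℝ} (ha : a ∈ unitI) : StrictAntiOn (excess f a) unitI := by
  intro q hq r hr hqr
  have hc : ContinuousOn (fun x => hFun f f x a) unitI :=
    A.hFun_continuousOn.comp (f := fun x : ℝ => (x, a)) (by fun_prop) fun x hx => ⟨hx, ha⟩
  rw [← sub_pos, A.excess_sub hq hr ha]
  exact intervalIntegral.intervalIntegral_pos_of_pos_on
    (intervalIntegrable_of_continuousOn_unitI hc hq hr)
    (fun x hx => A.hFun_pos ⟨hq.1.trans hx.1.le, hx.2.le.trans hr.2⟩ ha) hqr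

theorem excess_max_continuousOn {p a b : ℝ} (ha : a ∈ unitI) (hb : b ∈ unitI) (hp : p ≤ 1 + b) :
    ContinuousOn (fun t => excess f t (max a (p - t))) (Icc b 1) :=
  A.excess_continuousOn.comp (f := fun t : ℝ => (t, max a (p - t))) (by fun_prop)
    fun t ht => ⟨⟨hb.1.trans ht.1, ht.2⟩, ⟨ha.1.trans (le_max_left _ _),
      max_le ha.2 (by linarith [ht.1])⟩⟩

theorem excess_max_intervalIntegrable {p a b c d : ℝ} (ha : a ∈ unitI) (hb : b ∈ unitI)
    (hp : p ≤ 1 + b) (hc : c ∈ Icc b 1) (hd : d ∈ Icc b 1) :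
    IntervalIntegrable (fun t => excess f t (max a (p - t))) volume c d :=
  ((A.excess_max_continuousOn ha hb hp).mono
    ((convex_Icc b 1).ordConnected.uIcc_subset hc hd)).intervalIntegrable

/-- The slice at height `t` starts at `max a (p - t)`, and its mass beyond `f(1) f(t)` is the
excess; the right edge term cancels. The bound on `p` keeps these starting points in `[0, 1]`. -/
theorem deficiency_eq {p a b : ℝ} (ha : a ∈ unitI) (hb : b ∈ unitI) (hp : p ≤ 1 + b) :
    deficiency f p a b
      = (∫ t in b..1, excess f t (max a (p - t))) - f 1 * (1 - distr f a) := by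
  have hlo : ∀ t ∈ Ioo b 1, max a (p - t) ≤ 1 := fun t ht =>
    max_le ha.2 (by linarith [ht.1])
  have h := setIntegral_slices (measurableSet_region p a b) (region_subset_square p a b)
    A.hFun_integrableOn hb.2 (lo := fun t => max a (p - t)) hlo
    (fun t ht x => by
      constructor
      · rintro ⟨h1, h2, h3, h4⟩
        exact ⟨max_le h2 (by simp only at h4; linarith), h1.1.2⟩
      · rintro ⟨h1, h2⟩
        have h3 := (le_max_left _ _).trans h1
        have h4 := (le_max_right _ _).trans h1
        exact ⟨⟨⟨ha.1.trans h3, h2⟩, ⟨hb.1.trans ht.1.le, ht.2.le⟩⟩, h3, ht.1.le,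
          by simp only; linarith⟩)
    (fun x hx => ⟨hx.2.2.1, hx.1.2.2⟩)
  have h' : ∫ t in b..1, (∫ x in max a (p - t)..1, hFun f f x t)
      = ∫ t in b..1, (f 1 * f t + excess f t (max a (p - t))) := by
    refine intervalIntegral.integral_congr fun t ht => ?_
    rw [uIcc_of_le hb.2] at ht
    exact A.integral_hFun ⟨ha.1.trans (le_max_left _ _), max_le ha.2 (by linarith [ht.1])⟩
  rw [deficiency, h, h', intervalIntegral.integral_add
      ((intervalIntegrable_of_continuousOn_unitI A.continuousOn hb one_mem_unitI).const_mul _)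
      (A.excess_max_intervalIntegrable ha hb hp ⟨le_rfl, hb.2⟩ ⟨hb.2, le_rfl⟩),
    intervalIntegral.integral_const_mul, ← A.tail_eq hb]
  ring

theorem integral_excess {a b : ℝ} (hb : b ∈ unitI) :
    ∫ t in b..1, excess f t a
      = (1 - distr f b + (f 1 - b * f b)) * (1 - distr f a) - a * f a * (1 - distr f b) := by
  have i1 := intervalIntegrable_of_continuousOn_unitI A.continuousOn hb one_mem_unitI
  have i2 := intervalIntegrable_of_continuousOn_unitI A.scaledDeriv_continuousOn hb one_mem_unitI
  have : ∀ t, excess f t a = (2 * (1 - distr f a) - a * f a) * f t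
      + (1 - distr f a) * scaledDeriv f t := by
    intro t; rw [excess]; ring
  simp only [this]
  rw [intervalIntegral.integral_add (i1.const_mul _) (i2.const_mul _),
    intervalIntegral.integral_const_mul, intervalIntegral.integral_const_mul,
    A.integral_scaledDeriv hb, ← A.tail_eq hb]
  ring

theorem deficiency_of_le {p a b : ℝ} (ha : a ∈ unitI) (hb : b ∈ unitI) (hp : p ≤ a + b) :
    deficiency f p a b = (1 - distr f a) * (1 - distr f b) - b * f b * (1 - distr f a)
      - a * f a * (1 - distr f b) := by
  rw [A.deficiency_eq ha hb (by linarith [ha.2])]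
  have : ∫ t in b..1, excess f t (max a (p - t)) = ∫ t in b..1, excess f t a := by
    refine intervalIntegral.integral_congr fun t ht => ?_
    rw [uIcc_of_le hb.2] at ht
    rw [max_eq_left (by linarith [ht.1])]
  rw [this, A.integral_excess hb]
  ring

theorem deficiency_eq_gFun {p a b : ℝ} (ha : a ∈ Ico (0 : ℝ) 1) (hb : b ∈ Ico (0 : ℝ) 1)
    (hp : p ≤ a + b) :
    deficiency f p a b = (1 - distr f a) * (1 - distr f b) * (1 - gFun f a - gFun f b) := by
  rw [A.deficiency_of_le ⟨ha.1, ha.2.le⟩ ⟨hb.1, hb.2.le⟩ hp]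
  linear_combination (1 - distr f b) * A.gFun_mul_tail ha + (1 - distr f a) * A.gFun_mul_tail hb

/-- Below the price line, lowering `a` to `a'` adds slices that start at `p - t ≤ s(t)`, and these
have nonnegative excess. The coordinates are swapped so that `a` becomes the slicing variable. -/
theorem deficiency_le_of_le {p z a a' b : ℝ} (hz : z ∈ unitI) (hpz : p ≤ 1 + z)
    (hs : ∀ t ∈ Icc z 1, p ≤ t + sFun f t) (ha' : z ≤ a') (haa : a' ≤ a) (ha : a ≤ 1)
    (hb : b ∈ Icc z 1) (hab : a + b ≤ p) : deficiency f p a b ≤ deficiency f p a' b := by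
  have hbI : b ∈ unitI := ⟨hz.1.trans hb.1, hb.2⟩
  have haI : a ∈ unitI := ⟨hz.1.trans (ha'.trans haa), ha⟩
  have ha'I : a' ∈ unitI := ⟨hz.1.trans ha', haa.trans ha⟩
  rw [deficiency_comm f p a, deficiency_comm f p a', A.deficiency_eq hbI haI (by linarith),
    A.deficiency_eq hbI ha'I (by linarith)]
  rw [← intervalIntegral.integral_add_adjacent_intervals
    (A.excess_max_intervalIntegrable hbI ha'I (c := a') (d := a) (by linarith)
      ⟨le_rfl, ha'I.2⟩ ⟨haa, ha⟩)
    (A.excess_max_intervalIntegrable hbI ha'I (by linarith) ⟨haa, ha⟩ ⟨ha'I.2, le_rfl⟩)]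
  have : 0 ≤ ∫ t in a'..a, excess f t (max b (p - t)) := by
    refine intervalIntegral.integral_nonneg haa fun t ht => ?_
    have htI : t ∈ unitI := ⟨ha'I.1.trans ht.1, ht.2.trans ha⟩
    refine A.excess_nonneg htI (hbI.1.trans (le_max_left _ _)) ?_
    rw [max_eq_right (by linarith [ht.2])]
    linarith [hs t ⟨ha'.trans ht.1, htI.2⟩]
  linarith

/-- Corners below the price line are compared with `(z, z)` by lowering one coordinate at a time.
Above the line the sign is that of `1 - G(a) - G(b)`; on the line it is known from the first case,
and `G` increases. -/
theorem deficiency_nonpos {p z : ℝ} (hz : 0 ≤ z) (hzp : z ≤ p - z) (hpz : p - z < 1)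
    (hs : ∀ t ∈ Icc z 1, p ≤ t + sFun f t) (h0 : deficiency f p z z = 0) {a b : ℝ}
    (ha : a ∈ Icc z 1) (hb : b ∈ Icc z 1) : deficiency f p a b ≤ 0 := by
  have hz1 : z < 1 := hzp.trans_lt hpz
  have hzI : z ∈ unitI := ⟨hz, hz1.le⟩
  have hp1 : p ≤ 1 + z := by linarith
  have low : ∀ {a b : ℝ}, a ∈ Icc z 1 → b ∈ Icc z 1 → a + b ≤ p → deficiency f p a b ≤ 0 := by
    intro a b ha hb hab
    calc deficiency f p a b ≤ deficiency f p z b :=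
          A.deficiency_le_of_le hzI hp1 hs le_rfl ha.1 ha.2 hb hab
      _ = deficiency f p b z := deficiency_comm _ _ _ _
      _ ≤ deficiency f p z z :=
          A.deficiency_le_of_le hzI hp1 hs le_rfl hb.1 hb.2 ⟨le_rfl, hz1.le⟩ (by linarith [ha.1])
      _ = 0 := h0
  rcases le_total (a + b) p with hab | hab
  · exact low ha hb hab
  have haI : a ∈ unitI := ⟨hz.trans ha.1, ha.2⟩
  have hbI : b ∈ unitI := ⟨hz.trans hb.1, hb.2⟩
  by_cases h1 : a < 1 ∧ b < 1
  · have ha' : a ∈ Ico (0 : ℝ) 1 := ⟨haI.1, h1.1⟩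
    have hb' : b ∈ Ico (0 : ℝ) 1 := ⟨hbI.1, h1.2⟩
    have one_le : ∀ {a b : ℝ}, a ∈ Icc z 1 → b ∈ Icc z 1 → a < 1 → b < 1 → a + b = p →
        1 ≤ gFun f a + gFun f b := by
      intro a b ha hb ha1 hb1 hab
      have ha' : a ∈ Ico (0 : ℝ) 1 := ⟨hz.trans ha.1, ha1⟩
      have hb' : b ∈ Ico (0 : ℝ) 1 := ⟨hz.trans hb.1, hb1⟩
      have h := low ha hb hab.le
      rw [A.deficiency_eq_gFun ha' hb' hab.ge] at h
      have := nonpos_of_mul_nonpos_right h (mul_pos (A.tail_pos ha') (A.tail_pos hb'))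
      linarith
    rw [A.deficiency_eq_gFun ha' hb' hab]
    refine mul_nonpos_of_nonneg_of_nonpos
      (mul_nonneg (A.tail_pos ha').le (A.tail_pos hb').le) ?_
    -- The corner is moved down onto the line while both coordinates stay at least `z`: to `(a, p -
    -- a)` if `a ≤ p - z`, and otherwise to `(p - z, z)`.
    have mono := A.gFun_strictMonoOn.monotoneOn
    rcases le_total a (p - z) with hap | hap
    · have h2 := one_le (a := a) (b := p - a) ha ⟨by linarith, by linarith [ha.1]⟩ h1.1
        (by linarith [ha.1]) (by ring)
      have h3 := mono (a := p - a) ⟨by linarith, by linarith [ha.1]⟩ hb' (by linarith)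
      linarith
    · have h2 := one_le (a := p - z) (b := z) ⟨hzp, hpz.le⟩ ⟨le_rfl, hz1.le⟩ hpz hz1 (by ring)
      have h3 := mono (a := p - z) ⟨by linarith, hpz⟩ ha' hap
      have h4 := mono (a := z) ⟨hz, hz1⟩ hb' hb.1
      linarith
  -- One coordinate equals `1`, where `G` is not available; the product of tails vanishes instead.
  · rw [A.deficiency_of_le haI hbI hab]
    have ha0 : 0 ≤ a * f a * (1 - distr f b) :=
      mul_nonneg (mul_nonneg haI.1 (A.pos haI).le) (A.tail_nonneg hbI)
    have hb0 : 0 ≤ b * f b * (1 - distr f a) :=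
      mul_nonneg (mul_nonneg hbI.1 (A.pos hbI).le) (A.tail_nonneg haI)
    have hprod : (1 - distr f a) * (1 - distr f b) = 0 := by
      by_cases h : a < 1
      · have : b = 1 := le_antisymm hb.2 (not_lt.1 fun h' => h1 ⟨h, h'⟩)
        rw [this, A.distr_one]; ring
      · have : a = 1 := le_antisymm ha.2 (not_lt.1 h)
        rw [this, A.distr_one]; ring
    linarith

/-- Raising the price cuts off part of the region, and `h > 0`. The condition `2 * a < p'` ensures
that the slice at height `a` really shrinks. -/
theorem deficiency_strictAnti {p p' a : ℝ} (ha : a ∈ Ico (0 : ℝ) 1) (hpp : p < p')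
    (hap : 2 * a < p') (hp' : p' ≤ 1 + a) : deficiency f p' a a < deficiency f p a a := by
  have haI : a ∈ unitI := ⟨ha.1, ha.2.le⟩
  rw [A.deficiency_eq haI haI hp', A.deficiency_eq haI haI (hpp.le.trans hp')]
  have hm : ∀ {p t : ℝ}, p ≤ p' → t ∈ Icc a 1 → max a (p - t) ∈ unitI := fun hp ht =>
    ⟨ha.1.trans (le_max_left _ _), max_le haI.2 (by linarith [ht.1])⟩
  have : ∫ t in a..1, excess f t (max a (p' - t)) < ∫ t in a..1, excess f t (max a (p - t)) := by
    refine intervalIntegral.integral_lt_integral_of_continuousOn_of_le_of_exists_lt ha.2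
      (A.excess_max_continuousOn haI haI hp')
      (A.excess_max_continuousOn haI haI (hpp.le.trans hp')) ?_ ⟨a, ⟨le_rfl, ha.2.le⟩, ?_⟩
    · intro t ht
      have ht' : t ∈ Icc a 1 := Ioc_subset_Icc_self ht
      exact (A.excess_strictAntiOn ⟨haI.1.trans ht'.1, ht'.2⟩).antitoneOn (hm hpp.le ht')
        (hm le_rfl ht') (max_le_max_left _ (by linarith))
    · refine A.excess_strictAntiOn haI (hm hpp.le ⟨le_rfl, haI.2⟩) (hm le_rfl ⟨le_rfl, haI.2⟩) ?_
      rw [max_eq_right (a := a) (b := p' - a) (by linarith)]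
      exact max_lt (by linarith) (by linarith)
  linarith

/-- Clamping the arguments extends the integrand continuously to the plane, so joint continuity of
parametric primitives applies. -/
theorem deficiency_continuousOn :
    ContinuousOn (fun x : ℝ × ℝ => deficiency f x.1 x.2 x.2)
      {x | x.2 ∈ unitI ∧ x.1 ≤ 1 + x.2} := by
  set ψ : ℝ × ℝ → ℝ := fun x => excess f (projIcc 0 1 zero_le_one x.1)
    (projIcc 0 1 zero_le_one x.2) with hψ
  have hψc : Continuous ψ := by
    refine A.excess_continuousOn.comp_continuous
      (f := fun x : ℝ × ℝ => ((projIcc 0 1 zero_le_one x.1 : ℝ), (projIcc 0 1 zero_le_one x.2 : ℝ)))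
      ?_ fun x => ⟨Subtype.mem _, Subtype.mem _⟩
    have := continuous_projIcc (a := (0 : ℝ)) (b := 1) (h := zero_le_one)
    fun_prop
  have hJ : Continuous fun y : (ℝ × ℝ) × ℝ =>
      ∫ t in (1 : ℝ)..y.2, ψ (t, max y.1.2 (y.1.1 - t)) :=
    intervalIntegral.continuous_parametric_primitive_of_continuous
      (f := fun (x : ℝ × ℝ) (t : ℝ) => ψ (t, max x.2 (x.1 - t)))
      (by
        refine hψc.comp (f := fun y : (ℝ × ℝ) × ℝ => (y.2, max y.1.2 (y.1.1 - y.2))) ?_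
        fun_prop)
  have hJ' : Continuous fun x : ℝ × ℝ => ∫ t in (1 : ℝ)..x.2, ψ (t, max x.2 (x.1 - t)) :=
    hJ.comp (f := fun x : ℝ × ℝ => (x, x.2)) (by fun_prop)
  have hF : ContinuousOn (fun x : ℝ × ℝ => distr f x.2) {x | x.2 ∈ unitI ∧ x.1 ≤ 1 + x.2} :=
    A.distr_continuousOn.comp continuousOn_snd fun x hx => hx.1
  refine (hJ'.continuousOn.neg.sub (continuousOn_const.mul (continuousOn_const.sub hF))
    (f := fun x : ℝ × ℝ => -∫ t in (1 : ℝ)..x.2, ψ (t, max x.2 (x.1 - t)))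
    (g := fun x : ℝ × ℝ => f 1 * (1 - distr f x.2))).congr fun x hx => ?_
  rw [A.deficiency_eq hx.1 hx.1 hx.2, Pi.sub_apply, intervalIntegral.integral_symm 1 x.2]
  congr 2
  refine intervalIntegral.integral_congr fun t ht => ?_
  rw [uIcc_of_ge hx.1.2] at ht
  have ht1 : t ∈ Icc (0 : ℝ) 1 := ⟨hx.1.1.trans ht.1, ht.2⟩
  have ht2 : max x.2 (x.1 - t) ∈ Icc (0 : ℝ) 1 :=
    ⟨hx.1.1.trans (le_max_left _ _), max_le hx.1.2 (by linarith [ht.1, hx.2])⟩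
  simp only [hψ, projIcc_of_mem zero_le_one ht1, projIcc_of_mem zero_le_one ht2]

theorem excess_intervalIntegrable {a c d : ℝ} (ha : a ∈ unitI) (hc : c ∈ unitI) (hd : d ∈ unitI) :
    IntervalIntegrable (fun t => excess f t a) volume c d :=
  intervalIntegrable_of_continuousOn_unitI
    (A.excess_continuousOn.comp (f := fun t : ℝ => (t, a)) (by fun_prop) fun _ ht => ⟨ht, ha⟩)
    hc hd

theorem excess_antidiagonal_intervalIntegrable {p c d : ℝ} (hc : c ∈ unitI) (hd : d ∈ unitI)
    (hpc : p - c ∈ unitI) (hpd : p - d ∈ unitI) :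
    IntervalIntegrable (fun t => excess f t (p - t)) volume c d := by
  refine (A.excess_continuousOn.comp (f := fun t : ℝ => (t, p - t)) (s := uIcc c d)
    (by fun_prop) fun t ht => ⟨uIcc_subset_unitI hc hd ht, ?_⟩).intervalIntegrable
  rcases le_total c d with h | h
  · rw [uIcc_of_le h] at ht
    exact ⟨by linarith [hpd.1, ht.2], by linarith [hpc.2, ht.1]⟩
  · rw [uIcc_of_ge h] at ht
    exact ⟨by linarith [hpc.1, ht.2], by linarith [hpd.2, ht.1]⟩

theorem deficiency_diagonal_eq {p a : ℝ} (ha : a ∈ unitI) (hap : a ≤ p - a) (hpa : p - a ≤ 1) :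
    deficiency f p a a = (∫ t in a..(p - a), excess f t (p - t))
      + (∫ t in (p - a)..1, excess f t a) - f 1 * (1 - distr f a) := by
  have hp : p ≤ 1 + a := by linarith
  rw [A.deficiency_eq ha ha hp, ← intervalIntegral.integral_add_adjacent_intervals
    (A.excess_max_intervalIntegrable ha ha hp (c := a) (d := p - a) ⟨le_rfl, ha.2⟩ ⟨hap, hpa⟩)
    (A.excess_max_intervalIntegrable ha ha hp ⟨hap, hpa⟩ ⟨ha.2, le_rfl⟩)]
  congr 2
  · refine intervalIntegral.integral_congr fun t ht => ?_
    rw [uIcc_of_le hap] at ht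
    rw [max_eq_right (by linarith [ht.2])]
  · refine intervalIntegral.integral_congr fun t ht => ?_
    rw [uIcc_of_le hpa] at ht
    rw [max_eq_left (by linarith [ht.1])]

theorem integral_mul_density {c d : ℝ} (hc : c ∈ unitI) (hd : d ∈ unitI) :
    ∫ t in c..d, f 1 * f t = f 1 * (distr f d - distr f c) := by
  rw [intervalIntegral.integral_const_mul, A.distr_sub hc hd]

theorem mul_density_intervalIntegrable {c d : ℝ} (hc : c ∈ unitI) (hd : d ∈ unitI) :
    IntervalIntegrable (fun t => f 1 * f t) volume c d :=
  (intervalIntegrable_of_continuousOn_unitI A.continuousOn hc hd).const_mul _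

/-! ### The two price equations and their unique solutions. -/

theorem bundleExpr_eq {p : ℝ} (hp : p ∈ unitI) : bundleExpr f p = deficiency f p 0 0 := by
  have h1 : ∫ t in (0 : ℝ)..1, (∫ x in (0 : ℝ)..1, hFun f f x t)
      = ∫ t in (0 : ℝ)..1, (f 1 * f t + excess f t 0) :=
    intervalIntegral.integral_congr fun t _ => A.integral_hFun zero_mem_unitI
  have h2 : ∫ t in (0 : ℝ)..p, (∫ x in (0 : ℝ)..(p - t), hFun f f x t)
      = ∫ t in (0 : ℝ)..p, (excess f t 0 - excess f t (p - t)) := by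
    refine intervalIntegral.integral_congr fun t ht => ?_
    rw [uIcc_of_le hp.1] at ht
    exact (A.excess_sub zero_mem_unitI ⟨by linarith [ht.2], by linarith [ht.1, hp.2]⟩
      ⟨ht.1, ht.2.trans hp.2⟩).symm
  have i0 := A.excess_intervalIntegrable zero_mem_unitI zero_mem_unitI hp
  have i1 := A.excess_intervalIntegrable zero_mem_unitI hp one_mem_unitI
  have i2 := A.excess_intervalIntegrable zero_mem_unitI zero_mem_unitI one_mem_unitI
  have i3 := A.excess_antidiagonal_intervalIntegrable zero_mem_unitI hp (p := p) (by simpa using hp)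
    (by simpa using zero_mem_unitI)
  have h3 := intervalIntegral.integral_add_adjacent_intervals i0 i1
  rw [A.deficiency_diagonal_eq zero_mem_unitI (by simpa using hp.1) (by simpa using hp.2),
    bundleExpr, h1, h2, intervalIntegral.integral_add
      (A.mul_density_intervalIntegrable zero_mem_unitI one_mem_unitI) i2,
    intervalIntegral.integral_sub i0 i3,
    A.integral_mul_density zero_mem_unitI one_mem_unitI, A.distr_one, distr_zero]
  simp only [sub_zero]
  linarith

/-- No order between `z` and `s` is assumed: for `s < z` the oriented integral runs backwards, a
case that has to be excluded later. -/
theorem priceEquation_sub {z s : ℝ} (hz : z ∈ unitI) (hs : s ∈ unitI) :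
    (∫ x₂ in z..s, ∫ x₁ in (s + z - x₂)..1, hFun f f x₁ x₂)
      + (∫ x₂ in s..1, ∫ x₁ in z..1, hFun f f x₁ x₂)
      = f 1 * (1 - distr f z) + (∫ t in z..s, excess f t (s + z - t))
        + ∫ t in s..1, excess f t z := by
  have h1 : ∫ t in z..s, (∫ x in (s + z - t)..1, hFun f f x t)
      = ∫ t in z..s, (f 1 * f t + excess f t (s + z - t)) := by
    refine intervalIntegral.integral_congr fun t ht => A.integral_hFun ?_
    rcases le_total z s with h | h
    · rw [uIcc_of_le h] at ht
      exact ⟨by linarith [ht.2, hz.1], by linarith [ht.1, hs.2]⟩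
    · rw [uIcc_of_ge h] at ht
      exact ⟨by linarith [ht.2, hs.1], by linarith [ht.1, hz.2]⟩
  have h2 : ∫ t in s..1, (∫ x in z..1, hFun f f x t) = ∫ t in s..1, (f 1 * f t + excess f t z) :=
    intervalIntegral.integral_congr fun t _ => A.integral_hFun hz
  rw [h1, h2, intervalIntegral.integral_add (A.mul_density_intervalIntegrable hz hs)
      (A.excess_antidiagonal_intervalIntegrable hz hs (by simpa using hs) (by simpa using hz)),
    intervalIntegral.integral_add (A.mul_density_intervalIntegrable hs one_mem_unitI)
      (A.excess_intervalIntegrable hz hs one_mem_unitI),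
    A.integral_mul_density hz hs, A.integral_mul_density hs one_mem_unitI, A.distr_one]
  ring

theorem priceEquation_iff {z : ℝ} (hz : z ∈ unitI) (hzs : z ≤ sFun f z) :
    PriceEquation f (sFun f) z ↔ deficiency f (z + sFun f z) z z = 0 := by
  have hs := A.sFun_mem_unitI hz
  rw [PriceEquation, A.priceEquation_sub hz hs,
    A.deficiency_diagonal_eq hz (by linarith) (by linarith [hs.2]), add_sub_cancel_left,
    add_comm (sFun f z) z]
  constructor <;> intro h <;> linarith

/-- Monotonicity gives `G(z) ≥ G(s(z)) = 2 + H(z) ≥ 1`. -/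
theorem one_le_gFun {z : ℝ} (hz : z ∈ Ico (0 : ℝ) 1) (hzs : sFun f z ≤ z) : 1 ≤ gFun f z := by
  have hzI : z ∈ unitI := ⟨hz.1, hz.2.le⟩
  have := A.gFun_strictMonoOn.monotoneOn (A.sFun_mem_Ico hzI) hz hzs
  rw [A.gFun_sFun hzI] at this
  linarith [A.neg_one_le_etaFun hzI]

theorem deficiency_neg {z : ℝ} (hz : z ∈ Ico (0 : ℝ) 1) (hzs : sFun f z ≤ z) :
    deficiency f (z + z) z z < 0 := by
  rw [A.deficiency_eq_gFun hz hz le_rfl]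
  exact mul_neg_of_pos_of_neg (mul_pos (A.tail_pos hz) (A.tail_pos hz))
    (by linarith [A.one_le_gFun hz hzs])

/-- For `s(z) ≤ z`, monotonicity of the excess bounds the left side minus the right side by
`deficiency f (z + z) z z`, which is negative. -/
theorem not_priceEquation {z : ℝ} (hz : z ∈ Ico (0 : ℝ) 1) (hzs : sFun f z ≤ z) :
    ¬ PriceEquation f (sFun f) z := by
  have hzI : z ∈ unitI := ⟨hz.1, hz.2.le⟩
  have hs := A.sFun_mem_unitI hzI
  have hneg := A.deficiency_neg hz hzs
  rw [A.deficiency_diagonal_eq hzI (by linarith) (by linarith [hz.2]), add_sub_cancel_right,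
    intervalIntegral.integral_same] at hneg
  rw [PriceEquation, A.priceEquation_sub hzI hs]
  have h1 := intervalIntegral.integral_add_adjacent_intervals
    (A.excess_intervalIntegrable hzI hs hzI) (A.excess_intervalIntegrable hzI hzI one_mem_unitI)
  have h2 : ∫ t in (sFun f z)..z, excess f t z
      ≤ ∫ t in (sFun f z)..z, excess f t (sFun f z + z - t) := by
    refine intervalIntegral.integral_mono_on hzs (A.excess_intervalIntegrable hzI hs hzI)
      (A.excess_antidiagonal_intervalIntegrable hs hzI (by simpa using hzI) (by simpa using hs)) ?_
    intro t ht
    exact (A.excess_strictAntiOn ⟨hs.1.trans ht.1, ht.2.trans hz.2.le⟩).antitoneOn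
      ⟨by linarith [ht.2, hs.1], by linarith [ht.1, hz.2]⟩ hzI (by linarith [ht.1])
  rw [intervalIntegral.integral_symm (sFun f z) z]
  intro h
  linarith

theorem sFun_zero_mem : sFun f 0 ∈ Ioo (0 : ℝ) 1 := A.sFun_mem zero_mem_unitI

theorem deficiency_zero : deficiency f 0 0 0 = 1 := by
  rw [A.deficiency_of_le zero_mem_unitI zero_mem_unitI (by simp), distr_zero]
  ring

theorem existsUnique_bundleExpr_eq_zero (hE : bundleExpr f (sFun f 0) ≤ 0) :
    ∃! p : ℝ, p ∈ Icc 0 (sFun f 0) ∧ bundleExpr f p = 0 := by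
  have hs := A.sFun_zero_mem
  have hsub : ∀ {p}, p ∈ Icc 0 (sFun f 0) → p ∈ unitI := fun hp => ⟨hp.1, hp.2.trans hs.2.le⟩
  rw [A.bundleExpr_eq (Ioo_subset_Icc_self hs)] at hE
  have hc : ContinuousOn (fun p => deficiency f p 0 0) (Icc 0 (sFun f 0)) :=
    A.deficiency_continuousOn.comp (f := fun p : ℝ => (p, (0 : ℝ))) (by fun_prop)
      fun p hp => ⟨zero_mem_unitI, by simpa using (hsub hp).2⟩
  have hanti : ∀ {p p'}, p ∈ Icc 0 (sFun f 0) → p' ∈ Icc 0 (sFun f 0) → p < p' →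
      deficiency f p' 0 0 < deficiency f p 0 0 := fun hp hp' h =>
    A.deficiency_strictAnti ⟨le_rfl, zero_lt_one⟩ h (by simpa using hp.1.trans_lt h)
      (by simpa using (hsub hp').2)
  obtain ⟨p, hp, hp0⟩ := intermediate_value_Icc' hs.1.le hc
    (show (0 : ℝ) ∈ _ from ⟨hE, by rw [A.deficiency_zero]; exact zero_le_one⟩)
  refine ⟨p, ⟨hp, (A.bundleExpr_eq (hsub hp)).trans hp0⟩, ?_⟩
  rintro q ⟨hq, hq0⟩
  rw [A.bundleExpr_eq (hsub hq)] at hq0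
  simp only at hp0
  rcases lt_trichotomy p q with h | h | h
  · have := hanti hp hq h; linarith
  · exact h.symm
  · have := hanti hq hp h; linarith

theorem lt_sFun_of_priceEquation {z : ℝ} (hz : z ∈ Icc 0 (sFun f 0))
    (h : PriceEquation f (sFun f) z) : z < sFun f z := by
  by_contra! hcon
  exact A.not_priceEquation ⟨hz.1, hz.2.trans_lt A.sFun_zero_mem.2⟩ hcon h

theorem existsUnique_priceEquation (hE : ¬ bundleExpr f (sFun f 0) ≤ 0) :
    ∃! z : ℝ, z ∈ Icc 0 (sFun f 0) ∧ PriceEquation f (sFun f) z := by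
  have hs := A.sFun_zero_mem
  have hsI : sFun f 0 ∈ unitI := Ioo_subset_Icc_self hs
  have hsub : Icc 0 (sFun f 0) ⊆ unitI := Icc_subset_Icc_right hs.2.le
  rw [A.bundleExpr_eq hsI, not_le] at hE
  -- The fixed point `t` of `s` bounds the search: `z ≤ s(z)` on `[0, t]`, and the deficiency is
  -- positive at `0` by `hE` and negative at `t`.
  obtain ⟨t, ht, hts⟩ := intermediate_value_Icc' hs.1.le
    ((A.sFun_continuousOn.mono hsub).sub continuousOn_id)
    (show (0 : ℝ) ∈ _ from
      ⟨by simpa using A.sFun_antitoneOn zero_mem_unitI hsI hs.1.le, by simpa using hs.1.le⟩)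
  have hts' : sFun f t = t := by simpa [sub_eq_zero] using hts
  have htI : t ∈ unitI := hsub ht
  have hsub' : Icc 0 t ⊆ unitI := Icc_subset_Icc_right htI.2
  have hle : ∀ {z}, z ∈ Icc 0 t → z ≤ sFun f z := fun hz =>
    hz.2.trans (hts'.symm.le.trans (A.sFun_antitoneOn (hsub' hz) htI hz.2))
  have hc : ContinuousOn (fun z => deficiency f (z + sFun f z) z z) (Icc 0 t) := by
    refine A.deficiency_continuousOn.comp (f := fun z : ℝ => (z + sFun f z, z))
      ((continuousOn_id.add (A.sFun_continuousOn.mono hsub')).prodMk continuousOn_id)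
      fun z hz => ⟨hsub' hz, ?_⟩
    have := (A.sFun_mem (hsub' hz)).2
    simp only
    linarith
  obtain ⟨z, hz, hz0⟩ := intermediate_value_Icc' ht.1 hc
    (show (0 : ℝ) ∈ _ from ⟨by
      rw [hts']
      exact (A.deficiency_neg ⟨ht.1, ht.2.trans_lt hs.2⟩ hts'.le).le,
      by rw [zero_add]; exact hE.le⟩)
  have hzP := (A.priceEquation_iff (hsub' hz) (hle hz)).2 hz0
  have key : ∀ {z z'}, z ∈ Icc 0 (sFun f 0) → z' ∈ Icc 0 (sFun f 0) →
      PriceEquation f (sFun f) z → PriceEquation f (sFun f) z' → ¬ z < z' := by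
    intro z z' hz hz' h h' hlt
    have hl := A.lt_sFun_of_priceEquation hz h
    have hl' := A.lt_sFun_of_priceEquation hz' h'
    have h0 := (A.priceEquation_iff (hsub hz) hl.le).1 h
    have h0' := (A.priceEquation_iff (hsub hz') hl'.le).1 h'
    have hz1 := (hsub hz').2
    -- With the price of the smaller root `z`, the corner `(z', z')` has nonpositive deficiency. The
    -- price of `z'` is higher, so its deficiency is strictly negative and cannot vanish.
    have hd := A.deficiency_nonpos hz.1 (by linarith)
      (by linarith [(A.sFun_mem (hsub hz)).2]) (fun t ht => A.le_add_sFun hz le_rfl ht) h0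
      (a := z') (b := z') ⟨hlt.le, hz1⟩ ⟨hlt.le, hz1⟩
    have hsum : z + sFun f z < z' + sFun f z' :=
      A.add_sFun_strictMonoOn (hsub hz') hl'.le ⟨hz.1, hlt.le⟩ ⟨hz'.1, le_rfl⟩ hlt
    have := A.deficiency_strictAnti ⟨hz'.1, hl'.trans (A.sFun_mem (hsub hz')).2⟩ hsum
      (by linarith) (by linarith [(A.sFun_mem (hsub hz')).2])
    linarith
  have hz' : z ∈ Icc 0 (sFun f 0) := ⟨hz.1, hz.2.trans ht.2⟩
  refine ⟨z, ⟨hz', hzP⟩, ?_⟩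
  rintro y ⟨hy, hyP⟩
  exact le_antisymm (not_lt.1 (key hz' hy hzP hyP)) (not_lt.1 (key hy hz' hyP hzP))

end Admissible

/-! ### Maximality for the virtual revenue. -/

/-- `v` increases at most as fast as the sum of the increments of the coordinates. -/
def IsOneSidedLipschitz (v : ℝ × ℝ → ℝ) : Prop :=
  ∀ x ∈ square, ∀ y ∈ square, v y - v x ≤ max (y.1 - x.1) 0 + max (y.2 - x.2) 0

/-- The revenue functional after integration by parts. -/
def virtualRevenue (f : ℝ → ℝ) (v : ℝ × ℝ → ℝ) : ℝ :=
  (∫ t in (0 : ℝ)..1, f 1 * f t * v (1, t)) + (∫ t in (0 : ℝ)..1, f 1 * f t * v (t, 1))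
    - ∫ x in square, hFun f f x.1 x.2 * v x

/-- The layer-cake formula for the measure with density `d`. -/
theorem ofReal_setIntegral_mul_eq_lintegral_meas_lt {α : Type*} [MeasurableSpace α] {μ : Measure α}
    {S : Set α} (hS : MeasurableSet S) {d w : α → ℝ} (hd : AEMeasurable d (μ.restrict S))
    (hw : AEMeasurable w (μ.restrict S)) (hd0 : ∀ x ∈ S, 0 ≤ d x) (hw0 : ∀ x ∈ S, 0 ≤ w x)
    (hint : IntegrableOn (fun x => d x * w x) S μ) :
    ENNReal.ofReal (∫ x in S, d x * w x ∂μ)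
      = ∫⁻ c in Ioi (0 : ℝ),
          ((μ.restrict S).withDensity fun x => ENNReal.ofReal (d x)) {x | c < w x} := by
  have hac := withDensity_absolutelyContinuous (μ.restrict S) fun x => ENNReal.ofReal (d x)
  have hwnn : 0 ≤ᵐ[μ.restrict S] w := by
    filter_upwards [ae_restrict_mem hS] with x hx using hw0 x hx
  rw [← lintegral_eq_lintegral_meas_lt _ (hac.ae_le hwnn) (hw.mono_ac hac),
    lintegral_withDensity_eq_lintegral_mul₀ hd.ennreal_ofReal hw.ennreal_ofReal,
    ofReal_integral_eq_lintegral_ofReal hint]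
  · refine setLIntegral_congr_fun hS fun x hx => ?_
    simp only [Pi.mul_apply]
    rw [ENNReal.ofReal_mul (hd0 x hx)]
  · filter_upwards [ae_restrict_mem hS] with x hx using mul_nonneg (hd0 x hx) (hw0 x hx)

theorem exists_threshold {z : ℝ} (hz : z ≤ 1) {T : Set ℝ} (hT : T ⊆ Icc z 1)
    (hup : ∀ t ∈ T, ∀ t' ∈ Icc t 1, t' ∈ T) :
    ∃ a ∈ Icc z 1, (∀ t ∈ T, a ≤ t) ∧ Ioc a 1 ⊆ T := by
  have hbdd : BddBelow (insert 1 T) := ⟨z, by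
    rintro t (rfl | ht)
    · exact hz
    · exact (hT ht).1⟩
  -- Inserting `1` gives the threshold `1` when `T` is empty.
  refine ⟨sInf (insert 1 T), ⟨le_csInf (insert_nonempty _ _) ?_, csInf_le hbdd (mem_insert _ _)⟩,
    fun t ht => csInf_le hbdd (mem_insert_of_mem _ ht), ?_⟩
  · rintro t (rfl | ht)
    · exact hz
    · exact (hT ht).1
  · intro t ht
    obtain ⟨t', ht', hlt⟩ := exists_lt_of_csInf_lt (insert_nonempty _ _) ht.1
    rcases ht' with rfl | ht'
    · exact absurd hlt (not_lt.2 ht.2)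
    · exact hup t' ht' t ⟨hlt.le, ht.2⟩

theorem isClosed_region (p a b : ℝ) : IsClosed (region p a b) := by
  have h1 : IsClosed {x : ℝ × ℝ | a ≤ x.1} := isClosed_le continuous_const continuous_fst
  have h2 : IsClosed {x : ℝ × ℝ | b ≤ x.2} := isClosed_le continuous_const continuous_snd
  have h3 : IsClosed {x : ℝ × ℝ | p ≤ x.1 + x.2} := isClosed_le continuous_const (by fun_prop)
  exact isCompact_square.isClosed.inter (h1.inter (h2.inter h3))

theorem continuousOn_rightEdge {v : ℝ × ℝ → ℝ} (hv : ContinuousOn v square) :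
    ContinuousOn (fun t => v (1, t)) unitI :=
  hv.comp (f := fun t : ℝ => ((1 : ℝ), t)) (by fun_prop) fun _ ht => ⟨one_mem_unitI, ht⟩

theorem continuousOn_topEdge {v : ℝ × ℝ → ℝ} (hv : ContinuousOn v square) :
    ContinuousOn (fun t => v (t, 1)) unitI :=
  hv.comp (f := fun t : ℝ => (t, (1 : ℝ))) (by fun_prop) fun _ ht => ⟨ht, one_mem_unitI⟩

namespace Admissible

variable {f : ℝ → ℝ} (A : Admissible f)
include A

theorem integral_mul_density_tail {c : ℝ} (hc : c ∈ unitI) :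
    ∫ t in c..1, f 1 * f t = f 1 * (1 - distr f c) := by
  rw [A.integral_mul_density hc one_mem_unitI, A.distr_one]

theorem mul_density_mul_intervalIntegrable {φ : ℝ → ℝ} (hφ : ContinuousOn φ unitI) {c d : ℝ}
    (hc : c ∈ unitI) (hd : d ∈ unitI) :
    IntervalIntegrable (fun t => f 1 * f t * φ t) volume c d :=
  intervalIntegrable_of_continuousOn_unitI ((continuousOn_const.mul A.continuousOn).mul hφ) hc hd

theorem hFun_mul_integrableOn {w : ℝ × ℝ → ℝ} (hw : ContinuousOn w square) :
    IntegrableOn (fun x => hFun f f x.1 x.2 * w x) square :=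
  (A.hFun_continuousOn.mul hw).integrableOn_compact isCompact_square

/-- The comparison is made level by level. The thresholds `a` and `b` at which `w` exceeds `c` on
the top and right edges determine a corner region containing the superlevel set; its nonpositive
deficiency is the required inequality of masses. -/
theorem setIntegral_region_le_of_nonneg {p z : ℝ} (hz : z ∈ unitI)
    (hdef : ∀ a ∈ Icc z 1, ∀ b ∈ Icc z 1, deficiency f p a b ≤ 0)
    {w : ℝ × ℝ → ℝ} (hw : ContinuousOn w square) (hw0 : ∀ x ∈ square, 0 ≤ w x)
    (hmono : ∀ x ∈ square, z ≤ x.1 → z ≤ x.2 → p ≤ x.1 + x.2 →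
      ∀ y ∈ square, x.1 ≤ y.1 → x.2 ≤ y.2 → w x ≤ w y) (hp : p ≤ 1 + z) :
    ∫ x in region p z z, hFun f f x.1 x.2 * w x
      ≤ (∫ t in Icc z 1, f 1 * f t * w (1, t)) + ∫ t in Icc z 1, f 1 * f t * w (t, 1) := by
  have hsub := region_subset_square p z z
  have hsubI : Icc z 1 ⊆ unitI := Icc_subset_Icc_left hz.1
  have hf1 := (A.pos one_mem_unitI).le
  have hh : ContinuousOn (fun x : ℝ × ℝ => hFun f f x.1 x.2) (region p z z) :=
    A.hFun_continuousOn.mono hsub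
  have hfI : ContinuousOn (fun t => f 1 * f t) (Icc z 1) :=
    continuousOn_const.mul (A.continuousOn.mono hsubI)
  have hr := (continuousOn_rightEdge hw).mono hsubI
  have ht := (continuousOn_topEdge hw).mono hsubI
  have hf0 : ∀ t ∈ Icc z 1, 0 ≤ f 1 * f t := fun t h => mul_nonneg hf1 (A.pos (hsubI h)).le
  have hRc : IsCompact (region p z z) := isCompact_square.of_isClosed_subset (isClosed_region _ _ _)
    hsub
  have hR := hRc.measurableSet
  have e0 := ofReal_setIntegral_mul_eq_lintegral_meas_lt (μ := volume) hR (hh.aemeasurable hR)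
    ((hw.mono hsub).aemeasurable hR) (fun x hx => (A.hFun_pos (hsub hx).1 (hsub hx).2).le)
    (fun x hx => hw0 x (hsub hx)) ((hh.mul (hw.mono hsub)).integrableOn_compact hRc)
  have e1 := ofReal_setIntegral_mul_eq_lintegral_meas_lt (μ := volume) measurableSet_Icc
    (hfI.aemeasurable measurableSet_Icc) (hr.aemeasurable measurableSet_Icc) hf0
    (fun t h => hw0 (1, t) ⟨one_mem_unitI, hsubI h⟩)
    ((hfI.mul hr).integrableOn_compact isCompact_Icc)
  have e2 := ofReal_setIntegral_mul_eq_lintegral_meas_lt (μ := volume) measurableSet_Icc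
    (hfI.aemeasurable measurableSet_Icc) (ht.aemeasurable measurableSet_Icc) hf0
    (fun t h => hw0 (t, 1) ⟨hsubI h, one_mem_unitI⟩)
    ((hfI.mul ht).integrableOn_compact isCompact_Icc)
  have n1 : 0 ≤ ∫ t in Icc z 1, f 1 * f t * w (1, t) :=
    setIntegral_nonneg measurableSet_Icc fun t h =>
      mul_nonneg (hf0 t h) (hw0 (1, t) ⟨one_mem_unitI, hsubI h⟩)
  have n2 : 0 ≤ ∫ t in Icc z 1, f 1 * f t * w (t, 1) :=
    setIntegral_nonneg measurableSet_Icc fun t h =>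
      mul_nonneg (hf0 t h) (hw0 (t, 1) ⟨hsubI h, one_mem_unitI⟩)
  rw [← ENNReal.ofReal_le_ofReal_iff (add_nonneg n1 n2), ENNReal.ofReal_add n1 n2, e0, e1, e2,
    ← lintegral_add_left]
  swap
  · refine Antitone.measurable fun c c' hcc => measure_mono fun t h => ?_
    exact lt_of_le_of_lt hcc h
  refine lintegral_mono fun c => ?_
  obtain ⟨a, ha, hal, haT⟩ := exists_threshold (T := {t | t ∈ Icc z 1 ∧ c < w (t, 1)}) hz.2
    (fun t h => h.1) (fun t h t' h' => ⟨⟨h.1.1.trans h'.1, h'.2⟩, h.2.trans_le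
      (hmono (t, 1) ⟨hsubI h.1, one_mem_unitI⟩ h.1.1 hz.2 (by simp only; linarith [h.1.1])
        (t', 1) ⟨hsubI ⟨h.1.1.trans h'.1, h'.2⟩, one_mem_unitI⟩ h'.1 le_rfl)⟩)
  obtain ⟨b, hb, hbl, hbT⟩ := exists_threshold (T := {t | t ∈ Icc z 1 ∧ c < w (1, t)}) hz.2
    (fun t h => h.1) (fun t h t' h' => ⟨⟨h.1.1.trans h'.1, h'.2⟩, h.2.trans_le
      (hmono (1, t) ⟨one_mem_unitI, hsubI h.1⟩ hz.2 h.1.1 (by simp only; linarith [h.1.1])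
        (1, t') ⟨one_mem_unitI, hsubI ⟨h.1.1.trans h'.1, h'.2⟩⟩ le_rfl h'.1)⟩)
  have edge : ∀ {a : ℝ} {T : Set ℝ}, a ∈ Icc z 1 → Ioc a 1 ⊆ {t | t ∈ Icc z 1 ∧ t ∈ T} →
      ENNReal.ofReal (f 1 * (1 - distr f a)) ≤ ((volume.restrict (Icc z 1)).withDensity
        fun t => ENNReal.ofReal (f 1 * f t)) T := by
    intro a T ha hT
    have haI := hsubI ha
    rw [withDensity_apply' _ T, Measure.restrict_restrict' measurableSet_Icc,
      ← A.integral_mul_density_tail haI, intervalIntegral.integral_of_le ha.2,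
      ofReal_integral_eq_lintegral_ofReal
        ((intervalIntegrable_iff_integrableOn_Ioc_of_le ha.2).1
          (A.mul_density_intervalIntegrable haI one_mem_unitI))
        (by
          filter_upwards [ae_restrict_mem measurableSet_Ioc] with t h
          exact hf0 t ⟨ha.1.trans h.1.le, h.2⟩)]
    exact lintegral_mono_set fun t h => ⟨(hT h).2, (hT h).1⟩
  have hsubR := region_subset_square p a b
  have hpos : ∀ x ∈ square, 0 ≤ hFun f f x.1 x.2 := fun x hx => (A.hFun_pos hx.1 hx.2).le
  -- By monotonicity, `w x > c` forces `w > c` at the projections `(x.1, 1)` and `(1, x.2)`, whence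
  -- `x.1 ≥ a` and `x.2 ≥ b`.
  calc _ ≤ ∫⁻ x in region p a b, ENNReal.ofReal (hFun f f x.1 x.2) := by
        rw [withDensity_apply' _ {x | c < w x}, Measure.restrict_restrict' hR]
        refine lintegral_mono_set ?_
        rintro x ⟨hx, hxR⟩
        have hx1 : x.1 ∈ Icc z 1 := ⟨hxR.2.1, hxR.1.1.2⟩
        have hx2 : x.2 ∈ Icc z 1 := ⟨hxR.2.2.1, hxR.1.2.2⟩
        refine ⟨hxR.1, hal _ ⟨hx1, lt_of_lt_of_le hx ?_⟩, hbl _ ⟨hx2, lt_of_lt_of_le hx ?_⟩,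
          hxR.2.2.2⟩
        · exact hmono x hxR.1 hx1.1 hx2.1 hxR.2.2.2 _ ⟨hxR.1.1, one_mem_unitI⟩ le_rfl hx2.2
        · exact hmono x hxR.1 hx1.1 hx2.1 hxR.2.2.2 _ ⟨one_mem_unitI, hxR.1.2⟩ hx1.2 le_rfl
    _ = ENNReal.ofReal (∫ x in region p a b, hFun f f x.1 x.2) := by
        rw [ofReal_integral_eq_lintegral_ofReal (A.hFun_integrableOn.mono_set hsubR)]
        filter_upwards [ae_restrict_mem (measurableSet_region p a b)] with x hx
        exact hpos x (hsubR hx)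
    _ ≤ ENNReal.ofReal (f 1 * (1 - distr f b) + f 1 * (1 - distr f a)) := by
        refine ENNReal.ofReal_le_ofReal ?_
        have := hdef a ha b hb
        rw [deficiency] at this
        linarith
    _ = ENNReal.ofReal (f 1 * (1 - distr f b)) + ENNReal.ofReal (f 1 * (1 - distr f a)) :=
        ENNReal.ofReal_add (mul_nonneg hf1 (A.tail_nonneg (hsubI hb)))
          (mul_nonneg hf1 (A.tail_nonneg (hsubI ha)))
    _ ≤ _ := add_le_add (edge hb hbT) (edge ha haT)

/-- Adding a constant makes `w` nonnegative. It changes both sides equally, because `deficiency f p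
z z = 0` says that the total masses agree. -/
theorem setIntegral_region_le {p z : ℝ} (hz : z ∈ unitI)
    (hdef : ∀ a ∈ Icc z 1, ∀ b ∈ Icc z 1, deficiency f p a b ≤ 0) (h0 : deficiency f p z z = 0)
    {w : ℝ × ℝ → ℝ} (hw : ContinuousOn w square)
    (hmono : ∀ x ∈ square, z ≤ x.1 → z ≤ x.2 → p ≤ x.1 + x.2 →
      ∀ y ∈ square, x.1 ≤ y.1 → x.2 ≤ y.2 → w x ≤ w y) (hp : p ≤ 1 + z) :
    ∫ x in region p z z, hFun f f x.1 x.2 * w x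
      ≤ (∫ t in z..1, f 1 * f t * w (1, t)) + ∫ t in z..1, f 1 * f t * w (t, 1) := by
  obtain ⟨C, hC⟩ := isCompact_square.exists_bound_of_continuousOn hw
  have hsubI : Icc z 1 ⊆ unitI := Icc_subset_Icc_left hz.1
  have h := A.setIntegral_region_le_of_nonneg hz hdef (w := fun x => w x + C)
    (hw.add continuousOn_const)
    (fun x hx => by
      have := neg_le_of_abs_le (hC x hx)
      linarith)
    (fun x hx h1 h2 h3 y hy h4 h5 => add_le_add_left (hmono x hx h1 h2 h3 y hy h4 h5) C) hp
  have edge : ∀ {ψ : ℝ → ℝ}, ContinuousOn ψ unitI → ∫ t in Icc z 1, f 1 * f t * (ψ t + C)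
      = (∫ t in z..1, f 1 * f t * ψ t) + C * (f 1 * (1 - distr f z)) := by
    intro ψ hψ
    rw [integral_Icc_eq_integral_Ioc, ← intervalIntegral.integral_of_le hz.2,
      ← A.integral_mul_density_tail hz, ← intervalIntegral.integral_const_mul,
      ← intervalIntegral.integral_add]
    · refine intervalIntegral.integral_congr fun t _ => ?_
      ring
    · exact A.mul_density_mul_intervalIntegrable hψ hz one_mem_unitI
    · exact (A.mul_density_intervalIntegrable hz one_mem_unitI).const_mul C
  have hR : ∫ x in region p z z, hFun f f x.1 x.2 * (w x + C)
      = (∫ x in region p z z, hFun f f x.1 x.2 * w x)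
        + C * ∫ x in region p z z, hFun f f x.1 x.2 := by
    rw [← integral_const_mul, ← integral_add]
    · refine integral_congr_ae (Eventually.of_forall fun x => ?_)
      ring
    · exact (A.hFun_mul_integrableOn hw).mono_set
        (region_subset_square _ _ _)
    · exact (A.hFun_integrableOn.mono_set (region_subset_square _ _ _)).const_mul C
  rw [hR, edge (continuousOn_rightEdge hw), edge (continuousOn_topEdge hw)] at h
  rw [deficiency, sub_eq_zero] at h0
  rw [h0] at h
  linarith

/-- The points of the lower strip `x₂ < z` that are sold the first good. -/
theorem measurableSet_strip (z : ℝ) :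
    MeasurableSet {x : ℝ × ℝ | x ∈ square ∧ x.2 < z ∧ sFun f x.2 ≤ x.1} := by
  have hc : ContinuousOn (fun x : ℝ × ℝ => sFun f x.2 - x.1) square :=
    (A.sFun_continuousOn.comp continuousOn_snd fun x hx => hx.2).sub continuousOn_fst
  have h1 := (hc.preimage_isClosed_of_isClosed isCompact_square.isClosed
    (isClosed_Iic (a := (0 : ℝ)))).measurableSet
  have h2 : MeasurableSet {x : ℝ × ℝ | x.2 < z} := measurableSet_lt measurable_snd measurable_const
  convert h1.inter h2 using 1
  ext x
  simp only [mem_ofPred_eq, mem_inter_iff, mem_preimage, mem_Iic, sub_nonpos]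
  tauto

theorem setIntegral_strip_le {z : ℝ} (hz : z ∈ unitI) {w : ℝ × ℝ → ℝ} (hw : ContinuousOn w square)
    (hmono : ∀ t ∈ Ico 0 z, ∀ x ∈ Icc (sFun f t) 1, w (x, t) ≤ w (1, t)) :
    ∫ x in {x : ℝ × ℝ | x ∈ square ∧ x.2 < z ∧ sFun f x.2 ≤ x.1}, hFun f f x.1 x.2 * w x
      ≤ ∫ t in (0 : ℝ)..z, f 1 * f t * w (1, t) := by
  set S := {x : ℝ × ℝ | x ∈ square ∧ x.2 < z ∧ sFun f x.2 ≤ x.1} with hSdef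
  have hS : MeasurableSet S := A.measurableSet_strip z
  have hSq : S ⊆ square := fun x hx => hx.1
  have hw' : ContinuousOn (fun x : ℝ × ℝ => w (1, x.2)) square :=
    (continuousOn_rightEdge hw).comp continuousOn_snd fun x hx => hx.2
  have hφ : IntegrableOn (fun x : ℝ × ℝ => hFun f f x.1 x.2 * w (1, x.2)) square :=
    A.hFun_mul_integrableOn hw'
  calc _ ≤ ∫ x in S, hFun f f x.1 x.2 * w (1, x.2) := by
        refine setIntegral_mono_on
          ((A.hFun_mul_integrableOn hw).mono_set hSq)
          (hφ.mono_set hSq) hS fun x hx => ?_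
        exact mul_le_mul_of_nonneg_left (hmono x.2 ⟨hx.1.2.1, hx.2.1⟩ x.1 ⟨hx.2.2, hx.1.1.2⟩)
          (A.hFun_pos hx.1.1 hx.1.2).le
    _ = ∫ t in (0 : ℝ)..z, ∫ x in sFun f t..1, hFun f f x t * w (1, t) := by
        refine setIntegral_slices hS hSq hφ hz.1 (lo := sFun f)
          (fun t ht => (A.sFun_mem ⟨ht.1.le, ht.2.le.trans hz.2⟩).2.le) (fun t ht x => ?_)
          (fun x hx => ⟨hx.1.2.1, hx.2.1.le⟩)
        have htI : t ∈ unitI := ⟨ht.1.le, ht.2.le.trans hz.2⟩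
        constructor
        · exact fun h => ⟨h.2.2, h.1.1.2⟩
        · exact fun h => ⟨⟨⟨(A.sFun_mem htI).1.le.trans h.1, h.2⟩, htI⟩, ht.2, h.1⟩
    _ = _ := by
        refine intervalIntegral.integral_congr fun t ht => ?_
        rw [uIcc_of_le hz.1] at ht
        have htI : t ∈ unitI := ⟨ht.1, ht.2.trans hz.2⟩
        rw [intervalIntegral.integral_mul_const, A.integral_hFun (A.sFun_mem_unitI htI),
          A.excess_sFun htI, add_zero]

theorem virtualRevenue_sub {u v : ℝ × ℝ → ℝ} (hu : ContinuousOn u square)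
    (hv : ContinuousOn v square) :
    virtualRevenue f (fun x => u x - v x) = virtualRevenue f u - virtualRevenue f v := by
  have edge : ∀ {φ ψ : ℝ → ℝ}, ContinuousOn φ unitI → ContinuousOn ψ unitI →
      ∫ t in (0 : ℝ)..1, f 1 * f t * (φ t - ψ t)
        = (∫ t in (0 : ℝ)..1, f 1 * f t * φ t) - ∫ t in (0 : ℝ)..1, f 1 * f t * ψ t := by
    intro φ ψ hφ hψ
    rw [← intervalIntegral.integral_sub
      (A.mul_density_mul_intervalIntegrable hφ zero_mem_unitI one_mem_unitI)
      (A.mul_density_mul_intervalIntegrable hψ zero_mem_unitI one_mem_unitI)]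
    simp only [mul_sub]
  have hsq : ∫ x in square, hFun f f x.1 x.2 * (u x - v x)
      = (∫ x in square, hFun f f x.1 x.2 * u x) - ∫ x in square, hFun f f x.1 x.2 * v x := by
    rw [← integral_sub (A.hFun_mul_integrableOn hu) (A.hFun_mul_integrableOn hv)]
    simp only [mul_sub]
  rw [virtualRevenue, hsq, edge (continuousOn_rightEdge hu) (continuousOn_rightEdge hv),
    edge (continuousOn_topEdge hu) (continuousOn_topEdge hv), virtualRevenue, virtualRevenue]
  ring

/-- The four hypotheses on the values of `u` cover both menus: for bundling `z = 0` and the strips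
are empty. The condition `z ≤ s(z)` keeps the two strips disjoint. -/
theorem virtualRevenue_le {p z : ℝ} (hz : 0 ≤ z) (hzp : z ≤ p - z) (hpz : p - z < 1)
    (hzs : z ≤ sFun f z) (hs : ∀ t ∈ Icc z 1, p ≤ t + sFun f t) (h0 : deficiency f p z z = 0)
    {u v : ℝ × ℝ → ℝ} (hu : ContinuousOn u square) (hv : ContinuousOn v square)
    (hv0 : ∀ x ∈ square, 0 ≤ v x) (hvL : IsOneSidedLipschitz v)
    (hfull : ∀ x ∈ square, z ≤ x.1 → z ≤ x.2 → p ≤ x.1 + x.2 → u x = x.1 + x.2 - p)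
    (hfst : ∀ x ∈ square, x.2 < z → sFun f x.2 ≤ x.1 → u x = x.1 - sFun f x.2)
    (hsnd : ∀ x ∈ square, x.1 < z → sFun f x.1 ≤ x.2 → u x = x.2 - sFun f x.1)
    (hnone : ∀ x ∈ square, ¬ (z ≤ x.1 ∧ z ≤ x.2 ∧ p ≤ x.1 + x.2) →
      ¬ (x.2 < z ∧ sFun f x.2 ≤ x.1) → ¬ (x.1 < z ∧ sFun f x.1 ≤ x.2) → u x = 0) :
    virtualRevenue f v ≤ virtualRevenue f u := by
  have hz1 : z < 1 := hzp.trans_lt hpz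
  have hzI : z ∈ unitI := ⟨hz, hz1.le⟩
  set w : ℝ × ℝ → ℝ := fun x => u x - v x with hwdef
  have hw : ContinuousOn w square := hu.sub hv
  have hswap : MapsTo Prod.swap square square := fun x hx => ⟨hx.2, hx.1⟩
  have hws : ContinuousOn (fun x : ℝ × ℝ => w x.swap) square :=
    hw.comp continuous_swap.continuousOn hswap
  rw [← sub_nonneg, ← A.virtualRevenue_sub hu hv, ← hwdef, virtualRevenue, sub_nonneg]
  set S := {x : ℝ × ℝ | x ∈ square ∧ x.2 < z ∧ sFun f x.2 ≤ x.1} with hS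
  set S' := Prod.swap ⁻¹' S with hS'
  set R := region p z z with hR
  have mS : MeasurableSet S := A.measurableSet_strip z
  have mS' : MeasurableSet S' := measurable_swap mS
  have mR : MeasurableSet R := measurableSet_region p z z
  have sS : S ⊆ square := fun x hx => hx.1
  have sS' : S' ⊆ square := fun x hx => ⟨hx.1.2, hx.1.1⟩
  have sR : R ⊆ square := region_subset_square p z z
  have hint : IntegrableOn (fun x : ℝ × ℝ => hFun f f x.1 x.2 * w x) square :=
    A.hFun_mul_integrableOn hw
  have dSS' : Disjoint S S' := by
    refine Set.disjoint_left.2 fun x hx hx' => ?_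
    have h1 : x.1 < z := hx'.2.1
    have h2 := A.sFun_antitoneOn hx.1.2 hzI hx.2.1.le
    linarith [hx.2.2]
  have dR : Disjoint (S ∪ S') R := by
    refine Set.disjoint_left.2 fun x hx hx' => ?_
    rcases hx with hx | hx
    · exact absurd hx.2.1 (not_lt.2 hx'.2.2.1)
    · exact absurd hx.2.1 (not_lt.2 hx'.2.1)
  have mT : MeasurableSet (S ∪ S' ∪ R) := (mS.union mS').union mR
  have sT : S ∪ S' ∪ R ⊆ square := union_subset (union_subset sS sS') sR
  have hsplit : ∫ x in square, hFun f f x.1 x.2 * w x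
      = (∫ x in S, hFun f f x.1 x.2 * w x) + (∫ x in S', hFun f f x.1 x.2 * w x)
        + (∫ x in R, hFun f f x.1 x.2 * w x)
        + ∫ x in square \ (S ∪ S' ∪ R), hFun f f x.1 x.2 * w x := by
    rw [← setIntegral_union dSS' mS' (hint.mono_set sS) (hint.mono_set sS'),
      ← setIntegral_union dR mR (hint.mono_set (union_subset sS sS')) (hint.mono_set sR),
      ← setIntegral_union disjoint_sdiff_right (measurableSet_square.diff mT) (hint.mono_set sT)
        (hint.mono_set sdiff_subset), union_sdiff_cancel sT]
  have hrest : ∫ x in square \ (S ∪ S' ∪ R), hFun f f x.1 x.2 * w x ≤ 0 := by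
    refine setIntegral_nonpos (measurableSet_square.diff mT) fun x hx => ?_
    have hxs := hx.1
    have hu0 : u x = 0 := hnone x hxs
      (fun h => hx.2 (Or.inr ⟨hxs, h⟩)) (fun h => hx.2 (Or.inl (Or.inl ⟨hxs, h⟩)))
      (fun h => hx.2 (Or.inl (Or.inr ⟨hswap hxs, h⟩)))
    refine mul_nonpos_of_nonneg_of_nonpos (A.hFun_pos hxs.1 hxs.2).le ?_
    simp only [hwdef, hu0, zero_sub, neg_nonpos]
    exact hv0 x hxs
  have hline : ∀ t ∈ Ico 0 z, ∀ x ∈ Icc (sFun f t) 1,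
      t ∈ unitI ∧ x ∈ unitI ∧ sFun f t ≤ 1 := by
    intro t ht x hx
    have htI : t ∈ unitI := ⟨ht.1, ht.2.le.trans hz1.le⟩
    have hm := A.sFun_mem htI
    exact ⟨htI, ⟨hm.1.le.trans hx.1, hx.2⟩, hm.2.le⟩
  have iS : ∫ x in S, hFun f f x.1 x.2 * w x ≤ ∫ t in (0 : ℝ)..z, f 1 * f t * w (1, t) := by
    refine A.setIntegral_strip_le hzI hw fun t ht x hx => ?_
    obtain ⟨htI, hxI, hs1⟩ := hline t ht x hx
    have h1 := hfst (x, t) ⟨hxI, htI⟩ ht.2 hx.1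
    have h2 := hfst (1, t) ⟨one_mem_unitI, htI⟩ ht.2 hs1
    have h3 := hvL (x, t) ⟨hxI, htI⟩ (1, t) ⟨one_mem_unitI, htI⟩
    simp only [sub_self, max_self, add_zero] at h1 h2 h3
    rw [max_eq_left (by linarith [hxI.2])] at h3
    simp only [hwdef, h1, h2]
    linarith
  have iS' : ∫ x in S', hFun f f x.1 x.2 * w x ≤ ∫ t in (0 : ℝ)..z, f 1 * f t * w (t, 1) := by
    have h := A.setIntegral_strip_le hzI hws (fun t ht x hx => by
      obtain ⟨htI, hxI, hs1⟩ := hline t ht x hx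
      have h1 := hsnd (t, x) ⟨htI, hxI⟩ ht.2 hx.1
      have h2 := hsnd (t, 1) ⟨htI, one_mem_unitI⟩ ht.2 hs1
      have h3 := hvL (t, x) ⟨htI, hxI⟩ (t, 1) ⟨htI, one_mem_unitI⟩
      simp only [sub_self, max_self, zero_add] at h1 h2 h3
      rw [max_eq_left (by linarith [hxI.2])] at h3
      simp only [hwdef, h1, h2, Prod.swap_prod_mk]
      linarith)
    rw [← setIntegral_swap] at h
    simpa only [Prod.fst_swap, Prod.snd_swap, Prod.swap_swap, Prod.swap_prod_mk,
      fun x : ℝ × ℝ => hFun_comm f x.2 x.1] using h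
  have iR : ∫ x in R, hFun f f x.1 x.2 * w x
      ≤ (∫ t in z..1, f 1 * f t * w (1, t)) + ∫ t in z..1, f 1 * f t * w (t, 1) := by
    refine A.setIntegral_region_le hzI
      (fun a ha b hb => A.deficiency_nonpos hz hzp hpz hs h0 ha hb) h0 hw
      (fun x hx h1 h2 h3 y hy h4 h5 => ?_) (by linarith)
    have h6 := hvL x hx y hy
    rw [max_eq_left (by linarith), max_eq_left (by linarith)] at h6
    simp only [hwdef]
    rw [hfull x hx h1 h2 h3, hfull y hy (h1.trans h4) (h2.trans h5) (by linarith)]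
    linarith
  have jr := @mul_density_mul_intervalIntegrable f A _ (continuousOn_rightEdge hw)
  have jt := @mul_density_mul_intervalIntegrable f A _ (continuousOn_topEdge hw)
  rw [hsplit, ← intervalIntegral.integral_add_adjacent_intervals (jr zero_mem_unitI hzI)
      (jr hzI one_mem_unitI),
    ← intervalIntegral.integral_add_adjacent_intervals (jt zero_mem_unitI hzI)
      (jt hzI one_mem_unitI)]
  linarith

end Admissible

/-! ### Revenue as virtual revenue: integration by parts. -/

/-- The extension of a function on the square that is constant along the normals of the sides. -/
def clampExt (v : ℝ × ℝ → ℝ) (x : ℝ × ℝ) : ℝ :=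
  v (projIcc 0 1 zero_le_one x.1, projIcc 0 1 zero_le_one x.2)

/-- The one-sided Lipschitz condition on the whole plane. -/
def IsGlobalOneSidedLipschitz (v : ℝ × ℝ → ℝ) : Prop :=
  ∀ x y : ℝ × ℝ, v y - v x ≤ max (y.1 - x.1) 0 + max (y.2 - x.2) 0

theorem clampExt_eq (v : ℝ × ℝ → ℝ) {x : ℝ × ℝ} (hx : x ∈ square) : clampExt v x = v x := by
  rw [clampExt, projIcc_of_mem zero_le_one hx.1, projIcc_of_mem zero_le_one hx.2]

theorem projIcc_sub_le (s t : ℝ) :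
    ((projIcc 0 1 zero_le_one t : ℝ) - projIcc 0 1 zero_le_one s) ≤ max (t - s) 0 := by
  simp only [coe_projIcc]
  rcases le_total s t with h | h
  · rw [max_eq_left (a := t - s) (by linarith)]
    rcases max_cases 0 (min 1 t) with h1 | h1 <;> rcases max_cases 0 (min 1 s) with h2 | h2 <;>
      rcases min_cases 1 t with h3 | h3 <;> rcases min_cases 1 s with h4 | h4 <;> linarith
  · have : max 0 (min 1 t) ≤ max 0 (min 1 s) := max_le_max_left _ (min_le_min_left _ h)
    exact (sub_nonpos.2 this).trans (le_max_right _ _)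

theorem IsOneSidedLipschitz.clampExt {v : ℝ × ℝ → ℝ} (hv : IsOneSidedLipschitz v) :
    IsGlobalOneSidedLipschitz (clampExt v) := by
  intro x y
  refine (hv _ ⟨Subtype.mem _, Subtype.mem _⟩ _ ⟨Subtype.mem _, Subtype.mem _⟩).trans ?_
  exact add_le_add (max_le (projIcc_sub_le _ _) (le_max_right _ _))
    (max_le (projIcc_sub_le _ _) (le_max_right _ _))

theorem lipschitzWith_of_oneSided {φ : ℝ → ℝ} (hφ : ∀ s t, φ t - φ s ≤ max (t - s) 0) :
    LipschitzWith 1 φ := by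
  refine LipschitzWith.of_le_add fun s t => ?_
  have h := hφ t s
  have : max (s - t) 0 ≤ dist s t := by
    rw [Real.dist_eq]; exact max_le (le_abs_self _) (abs_nonneg _)
  linarith

theorem deriv_mem_of_oneSided {φ : ℝ → ℝ} (hφ : ∀ s t, φ t - φ s ≤ max (t - s) 0) (t : ℝ) :
    deriv φ t ∈ unitI := by
  have hmono : Monotone φ := fun s t h => by
    have := hφ t s
    rw [max_eq_right (by linarith)] at this
    linarith
  refine ⟨hmono.deriv_nonneg, ?_⟩
  have := norm_deriv_le_of_lipschitz (x₀ := t) (lipschitzWith_of_oneSided hφ)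
  rw [Real.norm_eq_abs] at this
  simpa using (le_abs_self _).trans this

namespace IsGlobalOneSidedLipschitz

variable {V : ℝ × ℝ → ℝ} (hV : IsGlobalOneSidedLipschitz V)
include hV

theorem fst (b s t : ℝ) : V (t, b) - V (s, b) ≤ max (t - s) 0 := by
  simpa using hV (s, b) (t, b)

theorem snd (a s t : ℝ) : V (a, t) - V (a, s) ≤ max (t - s) 0 := by
  simpa using hV (a, s) (a, t)

theorem lipschitzWith : LipschitzWith 2 V := by
  refine LipschitzWith.of_le_add_mul 2 fun x y => ?_
  have h := hV y x
  have h1 : max (x.1 - y.1) 0 ≤ dist x y :=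
    max_le ((le_abs_self _).trans (by rw [← Real.dist_eq]; exact le_max_left _ _)) dist_nonneg
  have h2 : max (x.2 - y.2) 0 ≤ dist x y :=
    max_le ((le_abs_self _).trans (by rw [← Real.dist_eq]; exact le_max_right _ _)) dist_nonneg
  push_cast
  linarith

theorem swap : IsGlobalOneSidedLipschitz fun x => V x.swap := fun x y => by
  simpa [add_comm] using hV x.swap y.swap

theorem partial₁_mem (x : ℝ × ℝ) : partial₁ V x ∈ unitI :=
  deriv_mem_of_oneSided (hV.fst x.2) x.1

theorem partial₂_mem (x : ℝ × ℝ) : partial₂ V x ∈ unitI :=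
  deriv_mem_of_oneSided (hV.snd x.1) x.2

theorem measurable_partial₁ : Measurable (partial₁ V) := by
  have := measurable_deriv_with_param (𝕜 := ℝ) (f := fun b t : ℝ => V (t, b))
    (hV.lipschitzWith.continuous.comp continuous_swap)
  exact this.comp measurable_swap

theorem measurable_partial₂ : Measurable (partial₂ V) :=
  measurable_deriv_with_param (𝕜 := ℝ) (f := fun a t : ℝ => V (a, t)) hV.lipschitzWith.continuous

end IsGlobalOneSidedLipschitz

theorem setIntegral_square {φ : ℝ × ℝ → ℝ} (hφ : IntegrableOn φ square) :
    ∫ x in square, φ x = ∫ t in (0 : ℝ)..1, ∫ x in (0 : ℝ)..1, φ (x, t) :=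
  setIntegral_slices measurableSet_square Subset.rfl hφ zero_le_one (lo := fun _ => 0)
    (fun _ _ => zero_le_one)
    (fun _ ht _ => ⟨fun h => h.1, fun h => ⟨h, Ioo_subset_Icc_self ht⟩⟩) (fun _ hx => hx.2)

theorem ae_mem_interior_square :
    ∀ᵐ x ∂(volume.restrict square), x ∈ Ioo (0 : ℝ) 1 ×ˢ Ioo (0 : ℝ) 1 := by
  have : volume.restrict square = volume.restrict (Ioo (0 : ℝ) 1 ×ˢ Ioo (0 : ℝ) 1) := by
    rw [square, unitI, Measure.volume_eq_prod, ← Measure.prod_restrict, ← Measure.prod_restrict,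
      restrict_Ioo_eq_restrict_Icc]
  rw [this]
  exact ae_restrict_mem (measurableSet_Ioo.prod measurableSet_Ioo)

theorem partial₁_congr {u v : ℝ × ℝ → ℝ} (h : EqOn u v square) {x : ℝ × ℝ}
    (hx : x ∈ Ioo (0 : ℝ) 1 ×ˢ Ioo (0 : ℝ) 1) : partial₁ u x = partial₁ v x := by
  refine EventuallyEq.deriv_eq ?_
  filter_upwards [Ioo_mem_nhds hx.1.1 hx.1.2] with t ht
  exact h ⟨Ioo_subset_Icc_self ht, Ioo_subset_Icc_self hx.2⟩

theorem partial₂_congr {u v : ℝ × ℝ → ℝ} (h : EqOn u v square) {x : ℝ × ℝ}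
    (hx : x ∈ Ioo (0 : ℝ) 1 ×ˢ Ioo (0 : ℝ) 1) : partial₂ u x = partial₂ v x := by
  refine EventuallyEq.deriv_eq ?_
  filter_upwards [Ioo_mem_nhds hx.2.1 hx.2.2] with t ht
  exact h ⟨Ioo_subset_Icc_self hx.1, Ioo_subset_Icc_self ht⟩

/-- The integrand of the revenue functional. -/
def revenueIntegrand (f : ℝ → ℝ) (u : ℝ × ℝ → ℝ) (x : ℝ × ℝ) : ℝ :=
  (partial₁ u x * x.1 + partial₂ u x * x.2 - u x) * f x.1 * f x.2

theorem revenueIntegrand_congr (f : ℝ → ℝ) {u v : ℝ × ℝ → ℝ} (h : EqOn u v square) {x : ℝ × ℝ}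
    (hx : x ∈ Ioo (0 : ℝ) 1 ×ˢ Ioo (0 : ℝ) 1) :
    revenueIntegrand f u x = revenueIntegrand f v x := by
  rw [revenueIntegrand, revenueIntegrand, partial₁_congr h hx, partial₂_congr h hx,
    h ⟨Ioo_subset_Icc_self hx.1, Ioo_subset_Icc_self hx.2⟩]

theorem utilityRevenue_congr (f : ℝ → ℝ) {u v : ℝ × ℝ → ℝ} (h : EqOn u v square) :
    utilityRevenue f f u = utilityRevenue f f v := by
  simp only [utilityRevenue, intervalIntegral.integral_of_le zero_le_one,
    integral_Ioc_eq_integral_Ioo]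
  refine setIntegral_congr_fun measurableSet_Ioo fun b hb =>
    setIntegral_congr_fun measurableSet_Ioo fun a ha => ?_
  exact revenueIntegrand_congr f h (x := (a, b)) ⟨ha, hb⟩

theorem virtualRevenue_congr (f : ℝ → ℝ) {u v : ℝ × ℝ → ℝ} (h : EqOn u v square) :
    virtualRevenue f u = virtualRevenue f v := by
  have h1 : ∫ t in (0 : ℝ)..1, f 1 * f t * u (1, t) = ∫ t in (0 : ℝ)..1, f 1 * f t * v (1, t) := by
    refine intervalIntegral.integral_congr fun t ht => ?_
    rw [uIcc_of_le zero_le_one] at ht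
    simp only [h (show ((1 : ℝ), t) ∈ square from ⟨one_mem_unitI, ht⟩)]
  have h2 : ∫ t in (0 : ℝ)..1, f 1 * f t * u (t, 1) = ∫ t in (0 : ℝ)..1, f 1 * f t * v (t, 1) := by
    refine intervalIntegral.integral_congr fun t ht => ?_
    rw [uIcc_of_le zero_le_one] at ht
    simp only [h (show (t, (1 : ℝ)) ∈ square from ⟨ht, one_mem_unitI⟩)]
  have h3 : ∫ x in square, hFun f f x.1 x.2 * u x = ∫ x in square, hFun f f x.1 x.2 * v x :=
    setIntegral_congr_fun measurableSet_square fun x hx => by simp only [h hx]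
  rw [virtualRevenue, virtualRevenue, h1, h2, h3]

theorem integrableOn_mul_of_mem {D : ℝ × ℝ → ℝ} (hD : Measurable D) (hD1 : ∀ x, D x ∈ unitI)
    {ψ : ℝ × ℝ → ℝ} (hψ : ContinuousOn ψ square) : IntegrableOn (fun x => D x * ψ x) square := by
  refine Integrable.bdd_mul (c := 1) (hψ.integrableOn_compact isCompact_square)
    hD.aestronglyMeasurable (Eventually.of_forall fun x => ?_)
  rw [Real.norm_eq_abs, abs_of_nonneg (hD1 x).1]
  exact (hD1 x).2

namespace Admissible

variable {f : ℝ → ℝ} (A : Admissible f)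
include A

/-- Integration by parts for two absolutely continuous functions: `φ` is Lipschitz, and `t f(t)`
inherits absolute continuity from `f`. -/
theorem integral_deriv_mul {φ : ℝ → ℝ} (hφ : ∀ s t, φ t - φ s ≤ max (t - s) 0) :
    ∫ t in (0 : ℝ)..1, deriv φ t * (t * f t)
      = f 1 * φ 1 - ∫ t in (0 : ℝ)..1, φ t * (f t + scaledDeriv f t) := by
  have h1 : AbsolutelyContinuousOnInterval φ 0 1 :=
    (lipschitzWith_of_oneSided hφ).lipschitzOnWith.absolutelyContinuousOnInterval
  have h2 : AbsolutelyContinuousOnInterval (fun t => t * f t) 0 1 :=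
    AbsolutelyContinuousOnInterval.fun_mul
      (LipschitzWith.id.lipschitzOnWith.absolutelyContinuousOnInterval) A.isDensity.absCont
  have h3 := AbsolutelyContinuousOnInterval.integral_mul_deriv_eq_deriv_mul h2 h1
  simp only [zero_mul, sub_zero, one_mul] at h3
  calc _ = ∫ t in (0 : ℝ)..1, t * f t * deriv φ t := by simp only [mul_comm]
    _ = _ := by
      rw [h3]
      congr 1
      rw [intervalIntegral.integral_of_le zero_le_one, intervalIntegral.integral_of_le zero_le_one,
        integral_Ioc_eq_integral_Ioo, integral_Ioc_eq_integral_Ioo]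
      refine setIntegral_congr_fun measurableSet_Ioo fun t ht => ?_
      have h4 := ((hasDerivAt_id' t).mul (A.hasDerivAt ht)).deriv
      have h5 : deriv (fun t => t * f t) t = f t + scaledDeriv f t := by
        rw [scaledDeriv, ← one_mul (f t)]; exact h4
      simp only [h5, mul_comm]

theorem continuousOn_density_fst : ContinuousOn (fun x : ℝ × ℝ => f x.1) square :=
  A.continuousOn.comp continuousOn_fst fun _ hx => hx.1

theorem continuousOn_density_snd : ContinuousOn (fun x : ℝ × ℝ => f x.2) square :=
  A.continuousOn.comp continuousOn_snd fun _ hx => hx.2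

theorem integrableOn_partial₁ {V : ℝ × ℝ → ℝ} (hV : IsGlobalOneSidedLipschitz V) :
    IntegrableOn (fun x => partial₁ V x * (x.1 * f x.1 * f x.2)) square :=
  integrableOn_mul_of_mem hV.measurable_partial₁ hV.partial₁_mem
    ((continuousOn_fst.mul A.continuousOn_density_fst).mul A.continuousOn_density_snd)

theorem integrableOn_partial₂ {V : ℝ × ℝ → ℝ} (hV : IsGlobalOneSidedLipschitz V) :
    IntegrableOn (fun x => partial₂ V x * (x.2 * f x.2 * f x.1)) square :=
  integrableOn_mul_of_mem hV.measurable_partial₂ hV.partial₂_mem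
    ((continuousOn_snd.mul A.continuousOn_density_snd).mul A.continuousOn_density_fst)

theorem continuousOn_add_scaledDeriv_fst {V : ℝ × ℝ → ℝ} (hV : ContinuousOn V square) :
    ContinuousOn (fun x : ℝ × ℝ => V x * (f x.1 + scaledDeriv f x.1) * f x.2) square :=
  (hV.mul (A.continuousOn_density_fst.add
    (A.scaledDeriv_continuousOn.comp continuousOn_fst fun _ hx => hx.1))).mul
    A.continuousOn_density_snd

theorem setIntegral_partial₁ {V : ℝ × ℝ → ℝ} (hV : IsGlobalOneSidedLipschitz V) :
    ∫ x in square, partial₁ V x * (x.1 * f x.1 * f x.2)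
      = (∫ t in (0 : ℝ)..1, f 1 * f t * V (1, t))
        - ∫ x in square, V x * (f x.1 + scaledDeriv f x.1) * f x.2 := by
  have hc : ContinuousOn V square := hV.lipschitzWith.continuous.continuousOn
  have i2 : IntegrableOn (fun x : ℝ × ℝ => V x * (f x.1 + scaledDeriv f x.1) * f x.2) square :=
    (A.continuousOn_add_scaledDeriv_fst hc).integrableOn_compact isCompact_square
  have i3 : IntegrableOn (fun x : ℝ × ℝ => f 1 * f x.2 * V (1, x.2)) square :=
    (((continuousOn_const.mul A.continuousOn_density_snd).mul
      ((continuousOn_rightEdge hc).comp continuousOn_snd fun _ hx => hx.2))).integrableOn_compact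
      isCompact_square
  have e3 : ∫ t in (0 : ℝ)..1, f 1 * f t * V (1, t)
      = ∫ x in square, f 1 * f x.2 * V (1, x.2) := by
    rw [setIntegral_square i3]
    simp
  rw [e3, ← integral_sub i3 i2, setIntegral_square (A.integrableOn_partial₁ hV),
    setIntegral_square (φ := fun x => f 1 * f x.2 * V (1, x.2)
      - V x * (f x.1 + scaledDeriv f x.1) * f x.2) (i3.sub i2)]
  refine intervalIntegral.integral_congr fun b hb => ?_
  rw [uIcc_of_le zero_le_one] at hb
  have h := A.integral_deriv_mul (hV.fst b)
  have i4 : IntervalIntegrable (fun a => V (a, b) * (f a + scaledDeriv f a)) volume 0 1 :=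
    intervalIntegrable_of_continuousOn_unitI
      ((hc.comp (f := fun a : ℝ => (a, b)) (by fun_prop) fun a ha => ⟨ha, hb⟩).mul
        (A.continuousOn.add A.scaledDeriv_continuousOn)) zero_mem_unitI one_mem_unitI
  calc _ = (∫ a in (0 : ℝ)..1, deriv (fun t => V (t, b)) a * (a * f a)) * f b := by
        rw [← intervalIntegral.integral_mul_const]
        refine intervalIntegral.integral_congr fun a _ => ?_
        simp only [partial₁]
        ring
    _ = _ := by
        rw [h, sub_mul, ← intervalIntegral.integral_mul_const]
        rw [intervalIntegral.integral_sub (by simp) (i4.mul_const (f b))]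
        simp
        ring

theorem setIntegral_partial₂ {V : ℝ × ℝ → ℝ} (hV : IsGlobalOneSidedLipschitz V) :
    ∫ x in square, partial₂ V x * (x.2 * f x.2 * f x.1)
      = (∫ t in (0 : ℝ)..1, f 1 * f t * V (t, 1))
        - ∫ x in square, V x * (f x.2 + scaledDeriv f x.2) * f x.1 := by
  have h := A.setIntegral_partial₁ hV.swap
  have hsq : Prod.swap ⁻¹' square = square := by
    ext x; exact and_comm
  rw [← setIntegral_swap, hsq, ← setIntegral_swap (fun x => _ * _ * _), hsq] at h
  simpa [partial₁, partial₂] using h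

theorem setIntegral_revenueIntegrand {V : ℝ × ℝ → ℝ} (hV : IsGlobalOneSidedLipschitz V) :
    IntegrableOn (revenueIntegrand f V) square ∧
      ∫ x in square, revenueIntegrand f V x = virtualRevenue f V := by
  have hc : ContinuousOn V square := hV.lipschitzWith.continuous.continuousOn
  have i1 := A.integrableOn_partial₁ hV
  have i2 := A.integrableOn_partial₂ hV
  have i3 : IntegrableOn (fun x => V x * (f x.1 * f x.2)) square :=
    (hc.mul (A.continuousOn_density_fst.mul A.continuousOn_density_snd)).integrableOn_compact
      isCompact_square
  have i4 := (A.continuousOn_add_scaledDeriv_fst hc).integrableOn_compact (μ := volume)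
    isCompact_square
  have i5 : IntegrableOn (fun x : ℝ × ℝ => V x * (f x.2 + scaledDeriv f x.2) * f x.1) square :=
    ((hc.mul (A.continuousOn_density_snd.add
      (A.scaledDeriv_continuousOn.comp continuousOn_snd fun _ hx => hx.2))).mul
      A.continuousOn_density_fst).integrableOn_compact isCompact_square
  have e : revenueIntegrand f V = fun x => partial₁ V x * (x.1 * f x.1 * f x.2)
      + partial₂ V x * (x.2 * f x.2 * f x.1) - V x * (f x.1 * f x.2) := by
    funext x; rw [revenueIntegrand]; ring
  have e' : (fun x : ℝ × ℝ => hFun f f x.1 x.2 * V x)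
      = fun x => V x * (f x.1 + scaledDeriv f x.1) * f x.2
        + V x * (f x.2 + scaledDeriv f x.2) * f x.1 + V x * (f x.1 * f x.2) := by
    funext x; rw [hFun_eq]; ring
  have i12 : IntegrableOn (fun x => partial₁ V x * (x.1 * f x.1 * f x.2)
      + partial₂ V x * (x.2 * f x.2 * f x.1)) square := i1.add i2
  have i45 : IntegrableOn (fun x : ℝ × ℝ => V x * (f x.1 + scaledDeriv f x.1) * f x.2
      + V x * (f x.2 + scaledDeriv f x.2) * f x.1) square := i4.add i5
  refine ⟨by rw [e]; exact i12.sub i3, ?_⟩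
  rw [e, virtualRevenue, e', integral_sub i12 i3, integral_add i1 i2, integral_add i45 i3,
    integral_add i4 i5, A.setIntegral_partial₁ hV, A.setIntegral_partial₂ hV]
  ring

/-- Partial derivatives in the interior see only values on the square, so `v` may be replaced by its
globally Lipschitz extension `clampExt v`, whose partials are measurable and bounded. -/
theorem utilityRevenue_eq {v : ℝ × ℝ → ℝ} (hv : IsOneSidedLipschitz v) :
    utilityRevenue f f v = virtualRevenue f v := by
  have h : EqOn v (clampExt v) square := fun x hx => (clampExt_eq v hx).symm
  obtain ⟨hi, he⟩ := A.setIntegral_revenueIntegrand hv.clampExt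
  rw [utilityRevenue_congr f h, virtualRevenue_congr f h, ← he, setIntegral_square hi]
  rfl

end Admissible

/-! ### Slope bounds for feasible utilities and truthful mechanisms. -/

theorem sub_le_of_convexOn_of_hasFDerivAt {E : Type*} [NormedAddCommGroup E] [NormedSpace ℝ E]
    {s : Set E} {v : E → ℝ} (hv : ConvexOn ℝ s v) {x y : E} (hx : x ∈ s) (hy : y ∈ s)
    {L : E →L[ℝ] ℝ} (hL : HasFDerivAt v L y) : v y - v x ≤ L (y - x) := by
  have hg : ConvexOn ℝ (Icc 0 1) (v ∘ AffineMap.lineMap (k := ℝ) y x) := by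
    refine (hv.comp_affineMap _).subset (fun t ht => ?_) (convex_Icc 0 1)
    exact hv.1.lineMap_mem hy hx ht
  have h0 : HasFDerivAt v L (AffineMap.lineMap (k := ℝ) y x (0 : ℝ)) := by simpa using hL
  have hd : HasDerivAt (v ∘ AffineMap.lineMap (k := ℝ) y x) (L (x - y)) 0 :=
    h0.comp_hasDerivAt 0 AffineMap.hasDerivAt_lineMap
  have h := hg.le_slope_of_hasDerivAt ⟨le_rfl, zero_le_one⟩ ⟨zero_le_one, le_rfl⟩ zero_lt_one hd
  rw [slope_def_field] at h
  simp only [Function.comp_apply, AffineMap.lineMap_apply_one, AffineMap.lineMap_apply_zero,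
    sub_zero, div_one] at h
  rw [← neg_sub x y, map_neg]
  linarith

theorem hasDerivAt_fst_of_hasFDerivAt {v : ℝ × ℝ → ℝ} {L : ℝ × ℝ →L[ℝ] ℝ} {y : ℝ × ℝ}
    (hL : HasFDerivAt v L y) : HasDerivAt (fun t => v (t, y.2)) (L (1, 0)) y.1 :=
  hL.comp_hasDerivAt y.1 ((hasDerivAt_id' y.1).prodMk (hasDerivAt_const y.1 y.2))

theorem hasDerivAt_snd_of_hasFDerivAt {v : ℝ × ℝ → ℝ} {L : ℝ × ℝ →L[ℝ] ℝ} {y : ℝ × ℝ}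
    (hL : HasFDerivAt v L y) : HasDerivAt (fun t => v (y.1, t)) (L (0, 1)) y.2 :=
  hL.comp_hasDerivAt y.2 ((hasDerivAt_const y.2 y.1).prodMk (hasDerivAt_id' y.2))

theorem apply_le_of_partials_mem {v : ℝ × ℝ → ℝ} {L : ℝ × ℝ →L[ℝ] ℝ} {y : ℝ × ℝ}
    (hL : HasFDerivAt v L y) (h1 : partial₁ v y ∈ unitI) (h2 : partial₂ v y ∈ unitI)
    (d : ℝ × ℝ) : L d ≤ max d.1 0 + max d.2 0 := by
  rw [partial₁, (hasDerivAt_fst_of_hasFDerivAt hL).deriv] at h1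
  rw [partial₂, (hasDerivAt_snd_of_hasFDerivAt hL).deriv] at h2
  have hd : d = d.1 • ((1 : ℝ), (0 : ℝ)) + d.2 • ((0 : ℝ), (1 : ℝ)) := by
    ext <;> simp
  have bound : ∀ {a c : ℝ}, c ∈ unitI → a * c ≤ max a 0 := fun {a c} hc => by
    rcases le_total 0 a with h | h
    · exact (mul_le_of_le_one_right h hc.2).trans (le_max_left _ _)
    · exact (mul_nonpos_of_nonpos_of_nonneg h hc.1).trans (le_max_right _ _)
  calc L d = d.1 * L (1, 0) + d.2 * L (0, 1) := by
        conv_lhs => rw [hd, map_add, map_smul, map_smul]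
        rfl
    _ ≤ _ := add_le_add (bound h1) (bound h2)

theorem interior_square : interior square = Ioo (0 : ℝ) 1 ×ˢ Ioo (0 : ℝ) 1 := by
  rw [square, unitI, interior_prod_eq, interior_Icc]

theorem closure_interior_square : closure (interior square) = square := by
  rw [interior_square, closure_prod_eq, closure_Ioo zero_ne_one]
  rfl

/-- The interior points at which `v` is differentiable with partial derivatives in `[0,1]`. -/
def smoothPoints (v : ℝ × ℝ → ℝ) : Set (ℝ × ℝ) :=
  {y | y ∈ interior square ∧ DifferentiableAt ℝ v y ∧ partial₁ v y ∈ unitI ∧ partial₂ v y ∈ unitI}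

/-- A convex function is locally Lipschitz in the interior, so Rademacher's theorem gives
differentiability almost everywhere; a set of full measure meets every nonempty open set. -/
theorem IsFeasibleUtility.square_subset_closure {v : ℝ × ℝ → ℝ} (hv : IsFeasibleUtility v) :
    square ⊆ closure (smoothPoints v) := by
  rw [← closure_interior_square]
  refine closure_minimal (fun x hx => ?_) isClosed_closure
  rw [mem_closure_iff_nhds]
  intro U hU
  obtain ⟨K, t, ht, hK⟩ := hv.convexOn.locallyLipschitzOn_interior hx
  rw [isOpen_interior.nhdsWithin_eq hx] at ht
  obtain ⟨W, hWsub, hWo, hxW⟩ := mem_nhds_iff.1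
    (inter_mem (inter_mem hU ht) (isOpen_interior.mem_nhds hx))
  have hLip : LipschitzOnWith K v W := hK.mono fun y hy => (hWsub hy).1.2
  have hWsq : W ⊆ square := fun y hy => interior_subset (hWsub hy).2
  have h1 : ∀ᵐ y ∂(volume.restrict W), DifferentiableAt ℝ v y := by
    rw [ae_restrict_iff' hWo.measurableSet]
    filter_upwards [hLip.ae_differentiableWithinAt_of_mem (μ := volume)] with y hy hyW
    exact (hy hyW).differentiableAt (hWo.mem_nhds hyW)
  have h2 := ae_restrict_of_ae_restrict_of_subset hWsq hv.partial₁_mem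
  have h3 := ae_restrict_of_ae_restrict_of_subset hWsq hv.partial₂_mem
  have : NeBot (ae (volume.restrict W)) := by
    rw [ae_neBot, Ne, Measure.restrict_eq_zero]
    exact (hWo.measure_pos volume ⟨x, hxW⟩).ne'
  obtain ⟨y, hyW, hy1, hy2, hy3⟩ :=
    ((ae_restrict_mem hWo.measurableSet).and (h1.and (h2.and h3))).exists
  exact ⟨y, (hWsub hyW).1.1, (hWsub hyW).2, hy1, hy2, hy3⟩

/-- The convex gradient inequality uses the derivative at the end point `y` only, so it suffices to
take `y` smooth and pass to the limit. -/
theorem IsFeasibleUtility.isOneSidedLipschitz {v : ℝ × ℝ → ℝ} (hv : IsFeasibleUtility v) :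
    IsOneSidedLipschitz v := by
  intro x hx y hy
  have hsub : smoothPoints v ⊆ square := fun y hy => interior_subset hy.1
  refine ContinuousWithinAt.closure_le (s := smoothPoints v)
    (f := fun y => v y - v x) (g := fun y => max (y.1 - x.1) 0 + max (y.2 - x.2) 0)
    (hv.square_subset_closure hy) (((hv.continuousOn y hy).mono hsub).sub
      continuousWithinAt_const) (by fun_prop) fun y hy => ?_
  have hL := hy.2.1.hasFDerivAt
  exact (sub_le_of_convexOn_of_hasFDerivAt hv.convexOn hx (hsub hy) hL).trans
    (apply_le_of_partials_mem hL hy.2.2.1 hy.2.2.2 _)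

theorem IsOneSidedLipschitz.continuousOn {v : ℝ × ℝ → ℝ} (hv : IsOneSidedLipschitz v) :
    ContinuousOn v square :=
  hv.clampExt.lipschitzWith.continuous.continuousOn.congr fun _ hx => (clampExt_eq v hx).symm

namespace Mechanism

variable {M : Mechanism} {u : ℝ × ℝ → ℝ}

/-- Incentive compatibility says that the allocation at `b` is a subgradient of `u` at `b`. -/
theorem IsTruthful.le_of_induces (hM : M.IsTruthful) (hu : M.Induces u) {b x : ℝ × ℝ}
    (hb : b ∈ square) (hx : x ∈ square) :
    u b + (M.alloc₁ b * (x.1 - b.1) + M.alloc₂ b * (x.2 - b.2)) ≤ u x := by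
  have h := hM.incentive_compatible x hx b hb
  rw [hu x hx] at h
  rw [← hu b hb]
  unfold Mechanism.utility at *
  linarith

theorem IsTruthful.isOneSidedLipschitz (hM : M.IsTruthful) (hu : M.Induces u) :
    IsOneSidedLipschitz u := by
  intro x hx y hy
  have h := hM.le_of_induces hu hy hx
  have bound : ∀ {a c : ℝ}, c ∈ unitI → c * a ≤ max a 0 := fun {a c} hc => by
    rcases le_total 0 a with h | h
    · exact (mul_le_of_le_one_left h hc.2).trans (le_max_left _ _)
    · exact (mul_nonpos_of_nonneg_of_nonpos hc.1 h).trans (le_max_right _ _)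
  have h1 := bound (a := y.1 - x.1) (hM.alloc₁_mem y hy)
  have h2 := bound (a := y.2 - x.2) (hM.alloc₂_mem y hy)
  linarith

theorem IsTruthful.convexOn (hM : M.IsTruthful) (hu : M.Induces u) : ConvexOn ℝ square u := by
  have hconv : Convex ℝ square := (convex_Icc 0 1).prod (convex_Icc 0 1)
  refine ⟨hconv, fun x hx y hy a b ha hb hab => ?_⟩
  have hc := hconv hx hy ha hb hab
  have h1 := mul_le_mul_of_nonneg_left (hM.le_of_induces hu hc hx) ha
  have h2 := mul_le_mul_of_nonneg_left (hM.le_of_induces hu hc hy) hb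
  simp only [Prod.fst_add, Prod.snd_add, Prod.smul_fst, Prod.smul_snd, smul_eq_mul] at h1 h2 ⊢
  set c := a • x + b • y
  have e : u c = a * (u c + (M.alloc₁ c * (x.1 - (a * x.1 + b * y.1))
        + M.alloc₂ c * (x.2 - (a * x.2 + b * y.2))))
      + b * (u c + (M.alloc₁ c * (y.1 - (a * x.1 + b * y.1))
        + M.alloc₂ c * (y.2 - (a * x.2 + b * y.2)))) := by
    have : b = 1 - a := by linarith
    rw [this]; ring
  rw [e]
  exact add_le_add h1 h2

theorem IsTruthful.isFeasibleUtility (hM : M.IsTruthful) (hu : M.Induces u) :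
    IsFeasibleUtility u := by
  have hL := hM.isOneSidedLipschitz hu
  have heq : EqOn u (clampExt u) square := fun x hx => (clampExt_eq u hx).symm
  refine ⟨fun x hx => ?_, hM.convexOn hu, hL.continuousOn, ?_, ?_⟩
  · rw [← hu x hx]; exact hM.individually_rational x hx
  · filter_upwards [ae_mem_interior_square] with x hx
    rw [partial₁_congr heq hx]
    exact hL.clampExt.partial₁_mem x
  · filter_upwards [ae_mem_interior_square] with x hx
    rw [partial₂_congr heq hx]
    exact hL.clampExt.partial₂_mem x

theorem eq_deriv_of_le {φ : ℝ → ℝ} {a t : ℝ} (hd : DifferentiableAt ℝ φ t)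
    (h : ∀ᶠ s in 𝓝 t, φ t + a * (s - t) ≤ φ s) : deriv φ t = a := by
  have hmin : IsLocalMin (fun s => φ s - a * (s - t)) t := by
    filter_upwards [h] with s hs
    simp only [sub_self, mul_zero, sub_zero]
    linarith
  have hder : HasDerivAt (fun s => φ s - a * (s - t)) (deriv φ t - a * 1) t :=
    hd.hasDerivAt.sub (((hasDerivAt_id' t).sub_const t).const_mul a)
  have := hmin.hasDerivAt_eq_zero hder
  linarith

theorem IsTruthful.alloc_eq_partial (hM : M.IsTruthful) (hu : M.Induces u) {x : ℝ × ℝ}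
    (hx : x ∈ Ioo (0 : ℝ) 1 ×ˢ Ioo (0 : ℝ) 1) (hd : DifferentiableAt ℝ (clampExt u) x) :
    M.alloc₁ x = partial₁ (clampExt u) x ∧ M.alloc₂ x = partial₂ (clampExt u) x := by
  have hxs : x ∈ square := ⟨Ioo_subset_Icc_self hx.1, Ioo_subset_Icc_self hx.2⟩
  constructor
  · refine (eq_deriv_of_le (hasDerivAt_fst_of_hasFDerivAt hd.hasFDerivAt).differentiableAt ?_).symm
    filter_upwards [Ioo_mem_nhds hx.1.1 hx.1.2] with t ht
    have hts : (t, x.2) ∈ square := ⟨Ioo_subset_Icc_self ht, hxs.2⟩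
    have := hM.le_of_induces hu hxs hts
    rw [clampExt_eq u hts, clampExt_eq u hxs]
    simpa using this
  · refine (eq_deriv_of_le (hasDerivAt_snd_of_hasFDerivAt hd.hasFDerivAt).differentiableAt ?_).symm
    filter_upwards [Ioo_mem_nhds hx.2.1 hx.2.2] with t ht
    have hts : (x.1, t) ∈ square := ⟨hxs.1, Ioo_subset_Icc_self ht⟩
    have := hM.le_of_induces hu hxs hts
    rw [clampExt_eq u hts, clampExt_eq u hxs]
    simpa using this

/-- At points of differentiability the subgradient is the gradient, so almost everywhere the payment
is determined by `u`. Hence the revenue depends on the utility alone. -/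
theorem IsTruthful.revenue_eq {f : ℝ → ℝ} (A : Admissible f) (hM : M.IsTruthful)
    (hu : M.Induces u) : M.revenue f f = virtualRevenue f u := by
  have hL := hM.isOneSidedLipschitz hu
  have heq : EqOn u (clampExt u) square := fun x hx => (clampExt_eq u hx).symm
  rw [virtualRevenue_congr f heq, ← (A.setIntegral_revenueIntegrand hL.clampExt).2,
    Mechanism.revenue]
  refine integral_congr_ae ?_
  filter_upwards [ae_mem_interior_square, ae_restrict_of_ae
    (hL.clampExt.lipschitzWith.ae_differentiableAt (μ := volume))] with x hx hd
  have hxs : x ∈ square := ⟨Ioo_subset_Icc_self hx.1, Ioo_subset_Icc_self hx.2⟩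
  obtain ⟨h1, h2⟩ := hM.alloc_eq_partial hu hx hd
  have h3 := hu x hxs
  rw [Mechanism.utility, h1, h2, heq hxs] at h3
  rw [revenueIntegrand, ← h3]
  ring

end Mechanism

/-- A continuous function that is induced by a truthful mechanism and dominates all one-sided
Lipschitz functions in virtual revenue gives the optimal mechanism. -/
theorem Admissible.optimalGivenBy {f : ℝ → ℝ} (A : Admissible f) {u : ℝ × ℝ → ℝ} {M : Mechanism}
    (hM : M.IsTruthful) (hu : M.Induces u)
    (hmax : ∀ v : ℝ × ℝ → ℝ, (∀ x ∈ square, 0 ≤ v x) → IsOneSidedLipschitz v →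
      virtualRevenue f v ≤ virtualRevenue f u) : OptimalGivenBy f f u := by
  have hL := hM.isOneSidedLipschitz hu
  refine ⟨⟨hM.isFeasibleUtility hu, fun v hv => ?_⟩, ⟨M, hM, hu⟩, fun M₁ hM₁ hu₁ =>
    ⟨hM₁, fun M₂ hM₂ => ?_⟩⟩
  · rw [A.utilityRevenue_eq hL, A.utilityRevenue_eq hv.isOneSidedLipschitz]
    exact hmax v hv.nonneg hv.isOneSidedLipschitz
  · have hu₂ : M₂.Induces fun x => M₂.utility x x := fun _ _ => rfl
    rw [hM₁.revenue_eq A hu₁, hM₂.revenue_eq A hu₂]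
    exact hmax _ hM₂.individually_rational (hM₂.isOneSidedLipschitz hu₂)

/-! ### Truthful mechanisms inducing the two candidate utilities. -/

theorem le_tangent_of_concaveOn {φ : ℝ → ℝ} (hφ : ConcaveOn ℝ unitI φ)
    (hd : DifferentiableOn ℝ φ unitI) {b x : ℝ} (hb : b ∈ unitI) (hx : x ∈ unitI) :
    φ x ≤ φ b + derivWithin φ unitI b * (x - b) := by
  rcases lt_trichotomy b x with h | h | h
  · have := hφ.slope_le_of_hasDerivWithinAt hb hx h (hd b hb).hasDerivWithinAt
    rw [slope_def_field, div_le_iff₀ (sub_pos.2 h)] at this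
    linarith
  · rw [h]; simp
  · have := hφ.le_slope_of_hasDerivWithinAt hx hb h (hd b hb).hasDerivWithinAt
    rw [slope_def_field, le_div_iff₀ (sub_pos.2 h)] at this
    linarith

theorem fullBundling_utility (p : ℝ) (b x : ℝ × ℝ) :
    (fullBundling p).utility b x = if p ≤ b.1 + b.2 then x.1 + x.2 - p else 0 := by
  simp only [Mechanism.utility, fullBundling]
  split_ifs <;> ring

theorem fullBundling_induces (p : ℝ) :
    (fullBundling p).Induces fun x => max 0 (x.1 + x.2 - p) := by
  intro x _
  rw [fullBundling_utility]
  split_ifs with h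
  · exact (max_eq_right (by linarith)).symm
  · exact (max_eq_left (by linarith)).symm

theorem fullBundling_isTruthful {p : ℝ} (hp : 0 ≤ p) : (fullBundling p).IsTruthful where
  alloc₁_mem b _ := by
    simp only [fullBundling]
    split_ifs
    exacts [one_mem_unitI, zero_mem_unitI]
  alloc₂_mem b _ := by
    simp only [fullBundling]
    split_ifs
    exacts [one_mem_unitI, zero_mem_unitI]
  pay_nonneg b _ := by
    simp only [fullBundling]
    split_ifs
    exacts [hp, le_rfl]
  incentive_compatible x hx b _ := by
    rw [fullBundling_induces p x hx, fullBundling_utility]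
    split_ifs
    exacts [le_max_right _ _, le_max_left _ _]
  individually_rational x hx := by
    rw [fullBundling_induces p x hx]
    exact le_max_left _ _

open Classical in
/-- The allocation probabilities and the payment of the mechanism with utility function
`curveUtility s p`: the gradient of the active branch and the matching price. -/
def curveMenu (s : ℝ → ℝ) (z p : ℝ) (b : ℝ × ℝ) : ℝ × ℝ × ℝ :=
  if z ≤ b.1 ∧ z ≤ b.2 ∧ p ≤ b.1 + b.2 then (1, 1, p)
  else if b.2 < z ∧ s b.2 ≤ b.1 then
    (1, -derivWithin s unitI b.2, s b.2 - b.2 * derivWithin s unitI b.2)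
  else if b.1 < z ∧ s b.1 ≤ b.2 then
    (-derivWithin s unitI b.1, 1, s b.1 - b.1 * derivWithin s unitI b.1)
  else (0, 0, 0)

/-- The mechanism that charges according to `curveMenu`. -/
def curveMechanism (s : ℝ → ℝ) (z p : ℝ) : Mechanism where
  alloc₁ b := (curveMenu s z p b).1
  alloc₂ b := (curveMenu s z p b).2.1
  pay b := (curveMenu s z p b).2.2

/-- The properties of the curve that separates the buyers of the first good from the others
which make `curveUtility s (z + s z)` the utility of a truthful mechanism. -/
structure IsPriceCurve (s : ℝ → ℝ) (z : ℝ) : Prop where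
  mem : z ∈ unitI
  le : z ≤ s z
  mapsTo : MapsTo s unitI unitI
  antitoneOn : AntitoneOn s unitI
  concaveOn : ConcaveOn ℝ unitI s
  differentiableOn : DifferentiableOn ℝ s unitI
  neg_one_le : ∀ t ∈ unitI, t ≤ s t → -1 ≤ derivWithin s unitI t
  le_add : ∀ t ∈ Icc z 1, z + s z ≤ t + s t
  add_le : ∀ t ∈ Icc 0 z, t + s t ≤ z + s z

theorem branches_le_curveUtility (s : ℝ → ℝ) (p : ℝ) (x : ℝ × ℝ) :
    0 ≤ curveUtility s p x ∧ x.1 - s x.2 ≤ curveUtility s p x ∧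
      x.2 - s x.1 ≤ curveUtility s p x ∧ x.1 + x.2 - p ≤ curveUtility s p x := by
  simp [curveUtility]

namespace IsPriceCurve

variable {s : ℝ → ℝ} {z : ℝ} (C : IsPriceCurve s z) {x : ℝ × ℝ}
include C

theorem curveUtility_full (hx : x ∈ square) (h1 : z ≤ x.1) (h2 : z ≤ x.2)
    (h3 : z + s z ≤ x.1 + x.2) : curveUtility s (z + s z) x = x.1 + x.2 - (z + s z) := by
  have e1 := C.le_add x.1 ⟨h1, hx.1.2⟩
  have e2 := C.le_add x.2 ⟨h2, hx.2.2⟩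
  rw [curveUtility, max_eq_right (a := x.2 - s x.1) (by linarith),
    max_eq_right (a := x.1 - s x.2) (by linarith), max_eq_right (by linarith)]

theorem le_of_mem_strip {a t : ℝ} (ht : t ∈ unitI) (htz : t < z) (h : s t ≤ a) : z ≤ a :=
  C.le.trans ((C.antitoneOn ht C.mem htz.le).trans h)

theorem curveUtility_fst (hx : x ∈ square) (h1 : x.2 < z) (h2 : s x.2 ≤ x.1) :
    curveUtility s (z + s z) x = x.1 - s x.2 := by
  have e1 := C.le_add x.1 ⟨C.le_of_mem_strip hx.2 h1 h2, hx.1.2⟩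
  have e2 := C.add_le x.2 ⟨hx.2.1, h1.le⟩
  rw [curveUtility, max_eq_left (b := max (x.2 - s x.1) _)
    (max_le (by linarith) (by linarith)), max_eq_right (by linarith)]

theorem curveUtility_snd (hx : x ∈ square) (h1 : x.1 < z) (h2 : s x.1 ≤ x.2) :
    curveUtility s (z + s z) x = x.2 - s x.1 := by
  have e1 := C.le_add x.2 ⟨C.le_of_mem_strip hx.1 h1 h2, hx.2.2⟩
  have e2 := C.add_le x.1 ⟨hx.1.1, h1.le⟩
  rw [curveUtility, max_eq_left (a := x.2 - s x.1) (by linarith),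
    max_eq_right (a := x.1 - s x.2) (by linarith), max_eq_right (by linarith)]

/-- All three nontrivial branches must be nonpositive. The position of each coordinate relative to
`z` decides whether `t + s(t)` lies above or below the price. -/
theorem curveUtility_none (hx : x ∈ square) (h1 : ¬ (z ≤ x.1 ∧ z ≤ x.2 ∧ z + s z ≤ x.1 + x.2))
    (h2 : ¬ (x.2 < z ∧ s x.2 ≤ x.1)) (h3 : ¬ (x.1 < z ∧ s x.1 ≤ x.2)) :
    curveUtility s (z + s z) x = 0 := by
  have key : x.1 ≤ s x.2 ∧ x.2 ≤ s x.1 ∧ x.1 + x.2 ≤ z + s z := by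
    rcases lt_or_ge x.1 z with ha | ha <;> rcases lt_or_ge x.2 z with hb | hb
    · have e1 : x.2 < s x.1 := not_le.1 fun h => h3 ⟨ha, h⟩
      have e2 : x.1 < s x.2 := not_le.1 fun h => h2 ⟨hb, h⟩
      have e3 := C.add_le x.1 ⟨hx.1.1, ha.le⟩
      exact ⟨e2.le, e1.le, by linarith⟩
    · have e1 : x.2 < s x.1 := not_le.1 fun h => h3 ⟨ha, h⟩
      have e2 := C.add_le x.1 ⟨hx.1.1, ha.le⟩
      have e3 := C.le_add x.2 ⟨hb, hx.2.2⟩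
      exact ⟨by linarith, e1.le, by linarith⟩
    · have e1 : x.1 < s x.2 := not_le.1 fun h => h2 ⟨hb, h⟩
      have e2 := C.add_le x.2 ⟨hx.2.1, hb.le⟩
      have e3 := C.le_add x.1 ⟨ha, hx.1.2⟩
      exact ⟨e1.le, by linarith, by linarith⟩
    · have e1 : x.1 + x.2 < z + s z := not_le.1 fun h => h1 ⟨ha, hb, h⟩
      have e2 := C.le_add x.2 ⟨hb, hx.2.2⟩
      have e3 := C.le_add x.1 ⟨ha, hx.1.2⟩
      exact ⟨by linarith, by linarith, e1.le⟩
  rw [curveUtility]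
  refine max_eq_left (max_le ?_ (max_le ?_ ?_)) <;> linarith [key.1, key.2.1, key.2.2]

/-- The chain `t < z ≤ s(z) ≤ s(t)` puts `t` where the slope is at least `-1`, so `-s'(t)` is a
probability. -/
theorem derivWithin_mem {t : ℝ} (ht : t ∈ unitI) (htz : t < z) :
    -derivWithin s unitI t ∈ unitI := by
  have h1 : derivWithin s unitI t ≤ 0 := C.antitoneOn.derivWithin_nonpos
  have h2 := C.neg_one_le t ht (htz.le.trans (C.le_of_mem_strip ht htz le_rfl))
  exact ⟨by linarith, by linarith⟩

theorem pay_nonneg {t : ℝ} (ht : t ∈ unitI) : 0 ≤ s t - t * derivWithin s unitI t := by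
  have h1 : derivWithin s unitI t ≤ 0 := C.antitoneOn.derivWithin_nonpos
  have h2 := mul_nonpos_of_nonneg_of_nonpos ht.1 h1
  linarith [(C.mapsTo ht).1]

/-- Every menu entry is an affine function of `x` touching `curveUtility` at `b`. It stays below
because the concave `s` lies under its tangents, so `x₁ - s(x₂)` lies above the corresponding affine
function. -/
theorem curveMenu_spec {b : ℝ × ℝ} (hb : b ∈ square) :
    (curveMenu s z (z + s z) b).1 ∈ unitI ∧ (curveMenu s z (z + s z) b).2.1 ∈ unitI ∧
    0 ≤ (curveMenu s z (z + s z) b).2.2 ∧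
    (curveMechanism s z (z + s z)).utility b b = curveUtility s (z + s z) b ∧
    ∀ x ∈ square,
      (curveMechanism s z (z + s z)).utility b x ≤ curveUtility s (z + s z) x := by
  have hbr := branches_le_curveUtility s (z + s z)
  simp only [Mechanism.utility, curveMechanism, curveMenu]
  split_ifs with h1 h2 h3
  · refine ⟨one_mem_unitI, one_mem_unitI, ?_, ?_, fun x hx => ?_⟩
    · exact add_nonneg C.mem.1 (C.mapsTo C.mem).1
    · rw [C.curveUtility_full hb h1.1 h1.2.1 h1.2.2]; ring
    · have := (hbr x).2.2.2
      linarith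
  · refine ⟨one_mem_unitI, C.derivWithin_mem hb.2 h2.1, C.pay_nonneg hb.2, ?_, fun x hx => ?_⟩
    · rw [C.curveUtility_fst hb h2.1 h2.2]; ring
    · have e1 := (hbr x).2.1
      have e2 := le_tangent_of_concaveOn C.concaveOn C.differentiableOn hb.2 hx.2
      linarith
  · refine ⟨C.derivWithin_mem hb.1 h3.1, one_mem_unitI, C.pay_nonneg hb.1, ?_, fun x hx => ?_⟩
    · rw [C.curveUtility_snd hb h3.1 h3.2]; ring
    · have e1 := (hbr x).2.2.1
      have e2 := le_tangent_of_concaveOn C.concaveOn C.differentiableOn hb.1 hx.1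
      linarith
  · refine ⟨zero_mem_unitI, zero_mem_unitI, le_rfl, ?_, fun x hx => ?_⟩
    · rw [C.curveUtility_none hb h1 h2 h3]; ring
    · have := (hbr x).1
      linarith

theorem curveMechanism_induces :
    (curveMechanism s z (z + s z)).Induces (curveUtility s (z + s z)) := fun _ hx =>
  (C.curveMenu_spec hx).2.2.2.1

theorem curveMechanism_isTruthful : (curveMechanism s z (z + s z)).IsTruthful where
  alloc₁_mem _ hb := (C.curveMenu_spec hb).1
  alloc₂_mem _ hb := (C.curveMenu_spec hb).2.1
  pay_nonneg _ hb := (C.curveMenu_spec hb).2.2.1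
  incentive_compatible x hx b hb := by
    rw [C.curveMechanism_induces x hx]
    exact (C.curveMenu_spec hb).2.2.2.2 x hx
  individually_rational x hx := by
    rw [C.curveMechanism_induces x hx]
    exact (branches_le_curveUtility s _ x).1

end IsPriceCurve

/-! ### Optimality of full bundling and of the curve menu. -/

namespace Admissible

variable {f : ℝ → ℝ} (A : Admissible f)
include A

theorem fullBundling_optimal {p : ℝ} (hp : p ∈ Icc 0 (sFun f 0)) (h0 : bundleExpr f p = 0) :
    IsOptimalMechanism f f (fullBundling p) ∧
      OptimalGivenBy f f (fun x => max 0 (x.1 + x.2 - p)) := by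
  have hs := A.sFun_zero_mem
  have hT := fullBundling_isTruthful hp.1
  have hI := fullBundling_induces p
  rw [A.bundleExpr_eq ⟨hp.1, hp.2.trans hs.2.le⟩] at h0
  have key : OptimalGivenBy f f (fun x => max 0 (x.1 + x.2 - p)) := by
    refine A.optimalGivenBy hT hI fun v hv0 hvL => ?_
    refine A.virtualRevenue_le (p := p) le_rfl (by simpa using hp.1)
      (by simpa using hp.2.trans_lt hs.2) hs.1.le
      (fun t ht => A.le_add_sFun ⟨le_rfl, hs.1.le⟩ (by simpa using hp.2) ht) h0
      (hT.isOneSidedLipschitz hI).continuousOn hvL.continuousOn hv0 hvL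
      (fun x _ _ _ h => max_eq_right (by linarith))
      (fun x hx h => absurd hx.2.1 (not_le.2 h)) (fun x hx h => absurd hx.1.1 (not_le.2 h))
      (fun x hx h _ _ => max_eq_left ?_)
    by_contra! hcon
    exact h ⟨hx.1.1, hx.2.1, by linarith⟩
  exact ⟨key.2.2 _ hT hI, key⟩

theorem isPriceCurve {z : ℝ} (hz : z ∈ Icc 0 (sFun f 0)) (hzs : z ≤ sFun f z) :
    IsPriceCurve (sFun f) z := by
  have hzI : z ∈ unitI := ⟨hz.1, hz.2.trans A.sFun_zero_mem.2.le⟩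
  exact ⟨hzI, hzs, fun t ht => A.sFun_mem_unitI ht, A.sFun_antitoneOn, A.sFun_concaveOn,
    A.sFun_differentiableOn, fun t ht h => (A.neg_one_lt_derivWithin_sFun ht h).le,
    fun t ht => A.le_add_sFun hz le_rfl ht, fun t ht => A.add_sFun_le hzI hzs ht⟩

theorem curveUtility_optimal {z : ℝ} (hz : z ∈ Icc 0 (sFun f 0))
    (h : PriceEquation f (sFun f) z) :
    OptimalGivenBy f f (curveUtility (sFun f) (z + sFun f z)) := by
  have hzs := A.lt_sFun_of_priceEquation hz h
  have C := A.isPriceCurve hz hzs.le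
  have h0 := (A.priceEquation_iff C.mem hzs.le).1 h
  refine A.optimalGivenBy C.curveMechanism_isTruthful C.curveMechanism_induces fun v hv0 hvL => ?_
  exact A.virtualRevenue_le hz.1 (by linarith) (by linarith [(A.sFun_mem C.mem).2]) hzs.le
    C.le_add h0
    (C.curveMechanism_isTruthful.isOneSidedLipschitz C.curveMechanism_induces).continuousOn
    hvL.continuousOn hv0 hvL
    (fun _ hx h1 h2 h3 => C.curveUtility_full hx h1 h2 h3)
    (fun _ hx h1 h2 => C.curveUtility_fst hx h1 h2)
    (fun _ hx h1 h2 => C.curveUtility_snd hx h1 h2)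
    (fun _ hx h1 h2 h3 => C.curveUtility_none hx h1 h2 h3)

end Admissible

end TwoGoods

end

theorem theorem2 (f : ℝ → ℝ) (hf : IsDensity f) (hreg : Regular f f)
    (hfd : DifferentiableOn ℝ f unitI)
    (hGd : DifferentiableOn ℝ (gFun f) (Ico 0 1))
    (hHd : DifferentiableOn ℝ (etaFun f) unitI)
    (hGmono : StrictMonoOn (gFun f) (Ico 0 1))
    (hGconv : ConvexOn ℝ (Ico 0 1) (gFun f))
    (hHanti : AntitoneOn (etaFun f) unitI)
    (hHconc : ConcaveOn ℝ unitI (etaFun f))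
    (hGH : MonotoneOn (fun t => gFun f t + etaFun f t) (Ico 0 1))
    (hG1 : ∃ L : EReal, Tendsto (fun t => ((gFun f t : ℝ) : EReal)) (𝓝[<] (1 : ℝ)) (𝓝 L) ∧
      ((2 + etaFun f 0 : ℝ) : EReal) ≤ L) :
    (MapsTo (sFun f) unitI (Ico 0 1) ∧ AntitoneOn (sFun f) unitI ∧ ConcaveOn ℝ unitI (sFun f) ∧
      DifferentiableOn ℝ (sFun f) unitI ∧
      (∀ t ∈ unitI, t ≤ sFun f t → -1 < derivWithin (sFun f) unitI t) ∧
      (∀ t ∈ unitI, sFun f t * f (sFun f t) / (1 - distr f (sFun f t)) = 2 + t * dens' f t / f t)) ∧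
    (bundleExpr f (sFun f 0) ≤ 0 →
      (∃! p : ℝ, p ∈ Icc 0 (sFun f 0) ∧ bundleExpr f p = 0) ∧
      ∀ p ∈ Icc 0 (sFun f 0), bundleExpr f p = 0 →
        IsOptimalMechanism f f (fullBundling p) ∧
        OptimalGivenBy f f (fun x => max 0 (x.1 + x.2 - p))) ∧
    (¬ bundleExpr f (sFun f 0) ≤ 0 →
      (∃! z : ℝ, z ∈ Icc 0 (sFun f 0) ∧ PriceEquation f (sFun f) z) ∧
      ∀ z ∈ Icc 0 (sFun f 0), PriceEquation f (sFun f) z →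
        OptimalGivenBy f f (curveUtility (sFun f) (z + sFun f z))) := by
  have A : Admissible f :=
    ⟨hf, hreg, hfd, hGd, hHd, hGmono, hGconv, hHanti, hHconc⟩
  exact ⟨⟨fun _ ht => A.sFun_mem_Ico ht, A.sFun_antitoneOn, A.sFun_concaveOn,
      A.sFun_differentiableOn, fun _ ht h => A.neg_one_lt_derivWithin_sFun ht h,
      fun _ ht => A.gFun_sFun ht⟩,
    fun hE => ⟨A.existsUnique_bundleExpr_eq_zero hE, fun _ hp h0 => A.fullBundling_optimal hp h0⟩,
    fun hE => ⟨A.existsUnique_priceEquation hE, fun _ hz h => A.curveUtility_optimal hz h⟩⟩
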